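/- **Setting.** On a probability space $(\Omega,\mathscr F,\mathbb P)$ consider, for $i=1,\dots,N$, the regressions $$y_{i,t}=\alpha_i+x_{i,t}'\beta_i+u_{i,t},\qquad t=1,2,\dots,$$ with $x_{i,t}\in\mathbb R^{k_i}$, $k=\sum_i k_i$, $u_t=(u_{1,t},\dots,u_{N,t})'$, $x_t=(x_{1,t}',\dots,x_{N,t}')'$, where the processes $x_t,u_t$ are indexed by $t\in\mathbb Z$, $\mathbb E[u_t]=0$ and $\mathbb E[x_t]=\mu_x$ for all $t$. Let $X_t\in\mathbb R^{k\times N}$ be the block-diagonal matrix with diagonal blocks $x_{1,t},\dots,x_{N,t}$, let $Z_t'=[I_N,\ X_t']$ and $\kappa=(\alpha',\beta')'$, so that $y_t=Z_t'\kappa+u_t$, and let $$\widehat\kappa^{OLS}_T=\Big(\sum_{t=1}^T Z_tZ_t'\Big)^{-1}\Big(\sum_{t=1}^T Z_ty_t\Big).$$ Put $\bar z_t=((x_t-\mu_x)',u_t')'\in\mathbb R^m$, $m=k+N$. Let $\mathscr H_t\subseteq L^2(\Omega;\mathbb R^m)$ be the closed linear span, with matrix coefficients, of $\bar z_t,\bar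 z_{t-1},\dots$, let $\mathscr P_{t-1}$ be the orthogonal projection onto $\mathscr H_{t-1}$, and let $\varepsilon_t=\bar z_t-\mathscr P_{t-1}[\bar z_t]$. **Assumption 1.** (A1.1) $\{\bar z_t\}$ is covariance-stationary with finite second moments and purely nondeterministic ($\bigcap_t\mathscr H_t=\{0\}$), and for some finite $p_0\ge1$ and all $t$, $\mathscr P_{t-1}[\bar z_t]$ equals the orthogonal projection of $\bar z_t$ onto the span (with matrix coefficients) of $\bar z_{t-1},\dots,\bar z_{t-p_0}$. (A1.2) For some $\delta>0$, $\{\varepsilon_t\}$ is strongly mixing with coefficients $$\alpha_\varepsilon(\ell)=\sup_t\ \sup\{|\mathbb P(A\cap B)-\mathbb P(A)\mathbb P(B)|:\ A\in\sigma(\varepsilon_s,s\le t),\ B\in\sigma(\varepsilon_s,s\ge t+\ell)\}$$ satisfying $\sum_{\ell\ge1}\alpha_\varepsilon(\ell)^{\delta/(2+\delta)}<\infty$; moreover $\sup_t\mathbb E\|\varepsilon_t\|^{4+2\delta}<\infty$, and $\Sigma=\mathbb E[\varepsilon_t\varepsilon_t']$ is positive definite. **Assumption 2.** $Q_Z:=\mathbb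 E[Z_tZ_t']$ is positive definite. **Proposition 3.** Under Assumptions 1 and 2, the OLS estimator $\widehat\kappa^{OLS}_T$ is consistent for $\kappa$ (that is, $\widehat\kappa^{OLS}_T\to\kappa$ in probability as $T\to\infty$) if and only if $\mathbb E[Z_tu_t]=0$; equivalently, if and only if the contemporaneous orthogonality condition $\mathbb E[X_tu_t]=0$ holds. In general, as $T\to\infty$, $$\widehat\kappa^{OLS}_T\ \xrightarrow{\ p\ }\ \kappa+Q_Z^{-1}\begin{pmatrix}0\\ \mathbb E[X_tu_t]\end{pmatrix}.$$ (The expectations $\mathbb E[Z_tZ_t']$, $\mathbb E[Z_tu_t]$, $\mathbb E[X_tu_t]$ do not depend on $t$.) -/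

import Mathlib

open MeasureTheory ProbabilityTheory Filter Topology
open scoped ENNReal NNReal Matrix

noncomputable section

namespace SUR

/- ### Second-order theory of a vector process indexed by the integers -/

section SecondOrder

variable {Ω : Type*} [MeasurableSpace Ω] {ι : Type*} [Fintype ι]

/-- Finite second moments, constant mean, and autocovariances `Cov(z_s, z_{s-ℓ})` that depend on
the lag `ℓ` only. -/
structure IsCovStationary (P : Measure Ω) (z : ℤ → Ω → EuclideanSpace ℝ ι) : Prop where
  memLp : ∀ t, MemLp (z t) 2 P
  mean_eq : ∀ s t, ∫ ω, z s ω ∂P = ∫ ω, z t ω ∂P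
  cov_eq : ∀ (ℓ s t : ℤ) (a b : ι),
    cov[fun ω => z s ω a, fun ω => z (s - ℓ) ω b; P]
      = cov[fun ω => z t ω a, fun ω => z (t - ℓ) ω b; P]

/-- The closed linear subspace of `L²(Ω; ℝ^ι)` generated by the vectors `z_s`, `s ∈ S`. As usual
for vector processes the linear combinations have matrix coefficients: the generators are the
random vectors `A z_s`, `A` a (constant) linear map. For finite `S` the span is finite-dimensional,
so that taking the closure changes nothing. -/
def closedSpan (P : Measure Ω) (z : ℤ → Ω → EuclideanSpace ℝ ι) (S : Set ℤ) :
    Submodule ℝ (Lp (EuclideanSpace ℝ ι) 2 P) :=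
  (Submodule.span ℝ {V : Lp (EuclideanSpace ℝ ι) 2 P |
    ∃ s ∈ S, ∃ A : EuclideanSpace ℝ ι →L[ℝ] EuclideanSpace ℝ ι,
      V =ᵐ[P] fun ω => A (z s ω)}).topologicalClosure

instance (P : Measure Ω) (z : ℤ → Ω → EuclideanSpace ℝ ι) (S : Set ℤ) :
    (closedSpan P z S).HasOrthogonalProjection :=
  inferInstanceAs (Submodule.topologicalClosure _).HasOrthogonalProjection

/-- `𝓗_t`, generated by the present and the past of the process. -/
def pastSpace (P : Measure Ω) (z : ℤ → Ω → EuclideanSpace ℝ ι) (t : ℤ) :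
    Submodule ℝ (Lp (EuclideanSpace ℝ ι) 2 P) :=
  closedSpan P z (Set.Iic t)

instance (P : Measure Ω) (z : ℤ → Ω → EuclideanSpace ℝ ι) (t : ℤ) :
    (pastSpace P z t).HasOrthogonalProjection :=
  inferInstanceAs (closedSpan P z _).HasOrthogonalProjection

/-- `𝓗_{t-1}^{(p)}`, generated by the last `p` values `z_{t-1}, …, z_{t-p}` before `t`. -/
def lagSpace (P : Measure Ω) (z : ℤ → Ω → EuclideanSpace ℝ ι) (p : ℕ) (t : ℤ) :
    Submodule ℝ (Lp (EuclideanSpace ℝ ι) 2 P) :=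
  closedSpan P z (Set.Icc (t - p) (t - 1))

instance (P : Measure Ω) (z : ℤ → Ω → EuclideanSpace ℝ ι) (p : ℕ) (t : ℤ) :
    (lagSpace P z p t).HasOrthogonalProjection :=
  inferInstanceAs (closedSpan P z _).HasOrthogonalProjection

/-- The one-step-ahead innovation `ε_t = z_t - 𝓟_{t-1}[z_t]`. -/
def innovation (P : Measure Ω) (z : ℤ → Ω → EuclideanSpace ℝ ι) (hz : ∀ t, MemLp (z t) 2 P)
    (t : ℤ) : Lp (EuclideanSpace ℝ ι) 2 P :=
  (hz t).toLp (z t) - (pastSpace P z (t - 1)).starProjection ((hz t).toLp (z t))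

/-- The process is purely nondeterministic: its remote past is trivial. -/
def IsPurelyNondeterministic (P : Measure Ω) (z : ℤ → Ω → EuclideanSpace ℝ ι) : Prop :=
  ⨅ t : ℤ, pastSpace P z t = ⊥

/-- The strong mixing coefficient
`α(ℓ) = sup_t sup { |P(A ∩ B) - P(A) P(B)| : A ∈ σ(e_s, s ≤ t), B ∈ σ(e_s, s ≥ t + ℓ) }`. -/
def mixingCoeff {E : Type*} [MeasurableSpace E] (P : Measure Ω) (e : ℤ → Ω → E) (ℓ : ℕ) : ℝ :=
  sSup {r : ℝ | ∃ (t : ℤ) (A B : Set Ω),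
    MeasurableSet[⨆ s : Set.Iic t, MeasurableSpace.comap (e s) inferInstance] A ∧
    MeasurableSet[⨆ s : Set.Ici (t + (ℓ : ℤ)), MeasurableSpace.comap (e s) inferInstance] B ∧
    r = |P.real (A ∩ B) - P.real A * P.real B|}

/-- The second-moment matrix `E[e e']` of a random vector. -/
def secondMoment (P : Measure Ω) (e : Ω → EuclideanSpace ℝ ι) : Matrix ι ι ℝ :=
  Matrix.of fun a b => ∫ ω, e ω a * e ω b ∂P

/-- Finite-predictor exactness at some finite lag, together with the mixing, moment and
nondegeneracy conditions on the innovations. -/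
structure FinitePredictorExactness (P : Measure Ω) (z : ℤ → Ω → EuclideanSpace ℝ ι) : Prop where
  stationary : IsCovStationary P z
  nondeterministic : IsPurelyNondeterministic P z
  exactness : ∃ p₀ : ℕ, 1 ≤ p₀ ∧ ∀ t : ℤ,
    (pastSpace P z (t - 1)).starProjection ((stationary.memLp t).toLp (z t))
      = (lagSpace P z p₀ t).starProjection ((stationary.memLp t).toLp (z t))
  mixing_moments : ∃ δ : ℝ, 0 < δ ∧
    Tendsto (mixingCoeff P fun t => ⇑(innovation P z stationary.memLp t)) atTop (𝓝 0) ∧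
    Summable (fun ℓ : ℕ =>
      mixingCoeff P (fun t => ⇑(innovation P z stationary.memLp t)) (ℓ + 1) ^ (δ / (2 + δ))) ∧
    ∃ C : ℝ≥0, ∀ t : ℤ,
      ∫⁻ ω, ‖innovation P z stationary.memLp t ω‖ₑ ^ (4 + 2 * δ) ∂P ≤ C
  posDef : ∀ t : ℤ, (secondMoment P (innovation P z stationary.memLp t)).PosDef

end SecondOrder

/- ### The regression system

There are `N` equations; equation `i` has the `k i` regressors `x i t ω 0, x i t ω 1, …`.
The stacked regressors are indexed by pairs `⟨i, j⟩` and the stacked coefficients `(α', β')'` by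
`Fin N ⊕ (Σ i, Fin (k i))`. -/

section Regression

variable {Ω : Type*} [MeasurableSpace Ω] {N : ℕ} {k : Fin N → ℕ}

/-- The centered joint vector `((x_t - μ_x)', u_t')'`. -/
def zbar (x : (i : Fin N) → ℤ → Ω → Fin (k i) → ℝ) (u : ℤ → Ω → Fin N → ℝ)
    (μx : (i : Fin N) → Fin (k i) → ℝ) (t : ℤ) (ω : Ω) :
    EuclideanSpace ℝ ((Σ i, Fin (k i)) ⊕ Fin N) :=
  WithLp.toLp 2 (Sum.elim (fun p => x p.1 t ω p.2 - μx p.1 p.2) (u t ω))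

/-- The block-diagonal regressor matrix `X_t`, of size `k × N`. -/
def X (x : (i : Fin N) → ℤ → Ω → Fin (k i) → ℝ) (t : ℤ) (ω : Ω) :
    Matrix (Σ i, Fin (k i)) (Fin N) ℝ :=
  Matrix.of fun p i => if p.1 = i then x p.1 t ω p.2 else 0

/-- `Z_t`, of size `(N + k) × N`, with `Z_t' = [I_N, X_t']`. -/
def Z (x : (i : Fin N) → ℤ → Ω → Fin (k i) → ℝ) (t : ℤ) (ω : Ω) :
    Matrix (Fin N ⊕ (Σ i, Fin (k i))) (Fin N) ℝ :=
  Matrix.fromRows 1 (X x t ω)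

/-- `κ = (α', β')'`. -/
def kappa (α : Fin N → ℝ) (β : (i : Fin N) → Fin (k i) → ℝ) : Fin N ⊕ (Σ i, Fin (k i)) → ℝ :=
  Sum.elim α fun p => β p.1 p.2

/-- The system OLS estimator from the observations `t = 1, …, T`. (Where the matrix is singular,
the inverse is `0` by convention.) -/
def ols (x : (i : Fin N) → ℤ → Ω → Fin (k i) → ℝ) (y : ℤ → Ω → Fin N → ℝ) (T : ℕ) (ω : Ω) :
    Fin N ⊕ (Σ i, Fin (k i)) → ℝ :=
  (∑ t ∈ Finset.Icc 1 T, Z x (t : ℤ) ω * (Z x (t : ℤ) ω)ᵀ)⁻¹ *ᵥ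
    (∑ t ∈ Finset.Icc 1 T, Z x (t : ℤ) ω *ᵥ y (t : ℤ) ω)

/-- `Q_Z = E[Z_t Z_t']`. -/
def QZ (P : Measure Ω) (x : (i : Fin N) → ℤ → Ω → Fin (k i) → ℝ) (t : ℤ) :
    Matrix (Fin N ⊕ (Σ i, Fin (k i))) (Fin N ⊕ (Σ i, Fin (k i))) ℝ :=
  Matrix.of fun a b => ∫ ω, (Z x t ω * (Z x t ω)ᵀ) a b ∂P

/-- `E[Z_t u_t]`. -/
def EZu (P : Measure Ω) (x : (i : Fin N) → ℤ → Ω → Fin (k i) → ℝ) (u : ℤ → Ω → Fin N → ℝ)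
    (t : ℤ) : Fin N ⊕ (Σ i, Fin (k i)) → ℝ :=
  fun a => ∫ ω, (Z x t ω *ᵥ u t ω) a ∂P

/-- `E[X_t u_t]`. -/
def EXu (P : Measure Ω) (x : (i : Fin N) → ℤ → Ω → Fin (k i) → ℝ) (u : ℤ → Ω → Fin N → ℝ)
    (t : ℤ) : (Σ i, Fin (k i)) → ℝ :=
  fun p => ∫ ω, (X x t ω *ᵥ u t ω) p ∂P

/-- The estimator sequence converges in probability to the constant `θ`; (weak) consistency
for `θ`. -/
def ConvergesInProbTo {ι : Type*} [Fintype ι] (P : Measure Ω) (est : ℕ → Ω → ι → ℝ)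
    (θ : ι → ℝ) : Prop :=
  TendstoInMeasure P est atTop fun _ => θ

end Regression

end SUR

end

/-!
By stationarity the Wold filter, which expresses `z̄_t` through the innovations, is the same at
all times and is approximated in `L²`, uniformly in `t`, by finite moving averages. Moment bounds
allow the innovations to be truncated uniformly in `t` as well. Hence every affine function of
`z̄_t` is an `L²` limit, and every product of two of them an `L¹` limit, uniformly in `t`, of
bounded functions of finitely many recent innovations. Such functions inherit the strong mixing,
so by the covariance inequality for bounded variables their averages concentrate at their means;
averaging contracts the `L¹` norm, so the limits obey the law of large numbers too. The estimator
is a function of the averages of `Z_t Z_t'` and `Z_t u_t`, continuous where the former is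
nonsingular.
-/

noncomputable section

open scoped BoundedContinuousFunction InnerProductSpace

namespace SUR

section CovarianceInequality

variable {Ω : Type*} {m m₁ m₂ : MeasurableSpace Ω} [mΩ : MeasurableSpace Ω] {P : Measure Ω}
  [IsProbabilityMeasure P] {X Y : Ω → ℝ} {M M' a : ℝ}

theorem integral_sub_integral_eq_zero (hY : Integrable Y P) : ∫ ω, (Y ω - P[Y]) ∂P = 0 := by
  rw [integral_sub hY (integrable_const _), integral_const, probReal_univ, one_smul, sub_self]

theorem covariance_eq_integral_mul_sub (hX : AEStronglyMeasurable X P) (hXM : ∀ ω, |X ω| ≤ M)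
    (hY : Integrable Y P) : cov[X, Y; P] = ∫ ω, X ω * (Y ω - P[Y]) ∂P := by
  have hc : Integrable (fun ω => Y ω - P[Y]) P := hY.sub (integrable_const _)
  have hXc : Integrable (fun ω => X ω * (Y ω - P[Y])) P := hc.bdd_mul hX (ae_of_all _ hXM)
  simp only [covariance, sub_mul]
  rw [integral_sub hXc (hc.const_mul _), integral_const_mul, integral_sub_integral_eq_zero hY,
    mul_zero, sub_zero]

theorem covariance_condExp_right (hm : m ≤ mΩ) (hX : Measurable[m] X) (hXM : ∀ ω, |X ω| ≤ M)
    (hY : Integrable Y P) : cov[X, P[Y | m]; P] = cov[X, Y; P] := by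
  have hX' : AEStronglyMeasurable X P := (hX.mono hm le_rfl).aestronglyMeasurable
  have hXY : Integrable (fun ω => X ω * Y ω) P := hY.bdd_mul hX' (ae_of_all _ hXM)
  have hXY' : Integrable (fun ω => X ω * (P[Y | m]) ω) P :=
    integrable_condExp.bdd_mul hX' (ae_of_all _ hXM)
  have hpull : P[fun ω => X ω * Y ω | m] =ᵐ[P] fun ω => X ω * (P[Y | m]) ω :=
    condExp_stronglyMeasurable_mul_of_bound hm hX.stronglyMeasurable hY M (ae_of_all _ hXM)
  have hXi : Integrable X P := .of_bound hX' M (ae_of_all _ hXM)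
  rw [covariance_eq_integral_mul_sub hX' hXM hY,
    covariance_eq_integral_mul_sub hX' hXM integrable_condExp, integral_condExp hm]
  simp only [mul_sub]
  rw [integral_sub hXY (hXi.mul_const _), integral_sub hXY' (hXi.mul_const _),
    ← integral_condExp hm (f := fun ω => X ω * Y ω), integral_congr_ae hpull]

omit mΩ in
theorem abs_indicator_one_le (A : Set Ω) (ω : Ω) : |A.indicator (1 : Ω → ℝ) ω| ≤ 1 := by
  by_cases h : ω ∈ A <;> simp [h]

theorem integral_abs_sub_integral_eq (hY : Measurable Y) (hYi : Integrable Y P) :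
    ∫ ω, |Y ω - P[Y]| ∂P = 2 * cov[{ω | P[Y] ≤ Y ω}.indicator 1, Y; P] := by
  set A := {ω | P[Y] ≤ Y ω}
  have h1A : AEStronglyMeasurable (A.indicator (1 : Ω → ℝ)) P :=
    (measurable_one.indicator (measurableSet_le measurable_const hY)).aestronglyMeasurable
  have hc : Integrable (fun ω => Y ω - P[Y]) P := hYi.sub (integrable_const _)
  have hAc : Integrable (fun ω => A.indicator 1 ω * (Y ω - P[Y])) P :=
    hc.bdd_mul h1A (ae_of_all _ (abs_indicator_one_le A))
  have habs : ∀ ω, |Y ω - P[Y]| = 2 * (A.indicator 1 ω * (Y ω - P[Y])) - (Y ω - P[Y]) := by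
    intro ω
    by_cases h : P[Y] ≤ Y ω
    · rw [abs_of_nonneg (sub_nonneg.2 h), Set.indicator_of_mem (by exact h), Pi.one_apply]; ring
    · rw [abs_of_neg (by linarith), Set.indicator_of_notMem (by exact h)]; ring
  simp only [habs]
  rw [integral_sub (hAc.const_mul 2) hc, integral_const_mul, integral_sub_integral_eq_zero hYi,
    covariance_eq_integral_mul_sub h1A (abs_indicator_one_le A) hYi, sub_zero]

theorem abs_covariance_le_indicator (hX : AEStronglyMeasurable X P) (hXM : ∀ ω, |X ω| ≤ M)
    (hY : Measurable Y) (hYi : Integrable Y P) :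
    |cov[X, Y; P]| ≤ 2 * M * cov[{ω | P[Y] ≤ Y ω}.indicator 1, Y; P] := by
  have hc : Integrable (fun ω => Y ω - P[Y]) P := hYi.sub (integrable_const _)
  calc |cov[X, Y; P]| = |∫ ω, X ω * (Y ω - P[Y]) ∂P| := by
        rw [covariance_eq_integral_mul_sub hX hXM hYi]
    _ ≤ ∫ ω, M * |Y ω - P[Y]| ∂P :=
        norm_integral_le_of_norm_le (hc.abs.const_mul M) <| ae_of_all _ fun ω => by
          rw [Real.norm_eq_abs, abs_mul]
          gcongr
          exact hXM ω
    _ = 2 * M * cov[{ω | P[Y] ≤ Y ω}.indicator 1, Y; P] := by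
        rw [integral_const_mul, integral_abs_sub_integral_eq hY hYi]
        ring

/-- Condition `Y` on `m` and take the event that the conditional expectation exceeds its mean. -/
theorem exists_abs_covariance_le_indicator (hm : m ≤ mΩ) (hX : Measurable[m] X)
    (hXM : ∀ ω, |X ω| ≤ M) (hY : Integrable Y P) :
    ∃ A, MeasurableSet[m] A ∧ |cov[X, Y; P]| ≤ 2 * M * cov[A.indicator 1, Y; P] := by
  have hg : Measurable[m] (P[Y | m]) := stronglyMeasurable_condExp.measurable
  have hA : MeasurableSet[m] {ω | P[P[Y | m]] ≤ (P[Y | m]) ω} :=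
    measurableSet_le measurable_const hg
  have h1A : Measurable[m] ({ω | P[P[Y | m]] ≤ (P[Y | m]) ω}.indicator (1 : Ω → ℝ)) :=
    Measurable.indicator (m := m) measurable_const hA
  refine ⟨_, hA, ?_⟩
  rw [← covariance_condExp_right hm hX hXM hY,
    ← covariance_condExp_right hm h1A (abs_indicator_one_le _) hY]
  exact abs_covariance_le_indicator (hX.mono hm le_rfl).aestronglyMeasurable hXM
    (hg.mono hm le_rfl) integrable_condExp

theorem covariance_indicator_one {A B : Set Ω} (hA : MeasurableSet A) (hB : MeasurableSet B) :
    cov[A.indicator 1, B.indicator 1; P] = P.real (A ∩ B) - P.real A * P.real B := by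
  have hL : ∀ {S : Set Ω}, MeasurableSet S → MemLp (S.indicator (1 : Ω → ℝ)) 2 P := fun hS =>
    (memLp_const (1 : ℝ)).indicator hS
  rw [covariance_eq_sub (hL hA) (hL hB), integral_indicator_one hA, integral_indicator_one hB,
    ← integral_indicator_one (hA.inter hB), ← Set.inter_indicator_one]

theorem abs_covariance_le_of_abs_le (h₁ : m₁ ≤ mΩ) (h₂ : m₂ ≤ mΩ) (hX : Measurable[m₁] X)
    (hXM : ∀ ω, |X ω| ≤ M) (hY : Measurable[m₂] Y) (hYM : ∀ ω, |Y ω| ≤ M')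
    (ha : ∀ A B, MeasurableSet[m₁] A → MeasurableSet[m₂] B →
      |P.real (A ∩ B) - P.real A * P.real B| ≤ a) :
    |cov[X, Y; P]| ≤ 4 * M * M' * a := by
  obtain ⟨ω⟩ : Nonempty Ω := P.nonempty_of_neZero
  have hM : 0 ≤ M := (abs_nonneg _).trans (hXM ω)
  have hM' : 0 ≤ M' := (abs_nonneg _).trans (hYM ω)
  have hYi : Integrable Y P :=
    .of_bound (hY.mono h₂ le_rfl).aestronglyMeasurable M' (ae_of_all _ hYM)
  obtain ⟨A, hA, hXA⟩ := exists_abs_covariance_le_indicator h₁ hX hXM hYi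
  obtain ⟨B, hB, hYB⟩ := exists_abs_covariance_le_indicator (P := P) h₂ hY hYM
    ((integrable_const (1 : ℝ)).indicator (h₁ _ hA))
  calc |cov[X, Y; P]| ≤ 2 * M * cov[A.indicator 1, Y; P] := hXA
    _ ≤ 2 * M * (2 * M' * cov[B.indicator 1, A.indicator 1; P]) := by
        rw [covariance_comm _ Y]
        gcongr
        exact (le_abs_self _).trans hYB
    _ ≤ 2 * M * (2 * M' * a) := by
        rw [covariance_comm, covariance_indicator_one (h₁ _ hA) (h₂ _ hB)]
        gcongr
        exact (le_abs_self _).trans (ha A B hA hB)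
    _ = 4 * M * M' * a := by ring

end CovarianceInequality

section Averages

variable {Ω : Type*} [MeasurableSpace Ω] {P : Measure Ω} [IsProbabilityMeasure P]

theorem sum_natAbs_sub_le {a : ℕ → ℝ} (ha : ∀ n, 0 ≤ a n) {T s : ℕ} (hs : s ∈ Finset.Icc 1 T) :
    ∑ t ∈ Finset.Icc 1 T, a ((s : ℤ) - t).natAbs ≤ 2 * ∑ n ∈ Finset.range T, a n := by
  rw [← Finset.sum_fiberwise_of_maps_to (t := Finset.range T)
    (g := fun t : ℕ => ((s : ℤ) - t).natAbs)
    (fun t ht => by simp only [Finset.mem_Icc, Finset.mem_range] at *; omega), Finset.mul_sum]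
  refine Finset.sum_le_sum fun n _ => ?_
  rw [Finset.sum_congr rfl (g := fun _ => a n)
    (fun t ht => by rw [(Finset.mem_filter.mp ht).2]), Finset.sum_const, nsmul_eq_mul]
  refine mul_le_mul_of_nonneg_right ?_ (ha n)
  have hsub : (Finset.Icc 1 T).filter (fun t : ℕ => ((s : ℤ) - t).natAbs = n) ⊆ {s + n, s - n} := by
    intro t ht
    simp only [Finset.mem_filter, Finset.mem_insert, Finset.mem_singleton] at *
    omega
  exact_mod_cast (Finset.card_le_card hsub).trans Finset.card_le_two

theorem tendsto_variance_average {b : ℤ → Ω → ℝ} (hb : ∀ t, MemLp (b t) 2 P) {a : ℕ → ℝ}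
    (ha : Tendsto a atTop (𝓝 0)) (hcov : ∀ s t, |cov[b s, b t; P]| ≤ a (s - t).natAbs) :
    Tendsto (fun T : ℕ => Var[fun ω => (T : ℝ)⁻¹ * ∑ t ∈ Finset.Icc 1 T, b t ω; P]) atTop
      (𝓝 0) := by
  have ha0 : ∀ n, 0 ≤ a n := fun n => (abs_nonneg _).trans (by simpa using hcov n 0)
  have hbound : ∀ T : ℕ, Var[fun ω => (T : ℝ)⁻¹ * ∑ t ∈ Finset.Icc 1 T, b t ω; P]
      ≤ 2 * ((T : ℝ)⁻¹ * ∑ n ∈ Finset.range T, a n) := by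
    intro T
    have hrow : ∀ s ∈ Finset.Icc 1 T, ∑ t ∈ Finset.Icc 1 T, cov[b s, b t; P]
        ≤ 2 * ∑ n ∈ Finset.range T, a n := fun s hs =>
      (Finset.sum_le_sum fun (t : ℕ) _ => (le_abs_self _).trans (hcov s t)).trans
        (sum_natAbs_sub_le ha0 hs)
    calc Var[fun ω => (T : ℝ)⁻¹ * ∑ t ∈ Finset.Icc 1 T, b t ω; P]
        = (T : ℝ)⁻¹ ^ 2 * ∑ s ∈ Finset.Icc 1 T, ∑ t ∈ Finset.Icc 1 T, cov[b s, b t; P] := by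
          rw [variance_const_mul, variance_fun_sum' (X := fun t : ℕ => b t) fun t _ => hb t]
      _ ≤ (T : ℝ)⁻¹ ^ 2 * ∑ s ∈ Finset.Icc 1 T, 2 * ∑ n ∈ Finset.range T, a n := by
          gcongr with s hs
          exact hrow s hs
      _ = 2 * ((T : ℝ)⁻¹ * ∑ n ∈ Finset.range T, a n) := by
          rcases T.eq_zero_or_pos with rfl | hT
          · simp
          · simp only [Finset.sum_const, Nat.card_Icc, Nat.add_sub_cancel, nsmul_eq_mul]
            field_simp
  refine squeeze_zero (fun T => variance_nonneg _ _) hbound ?_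
  simpa using ha.cesaro.const_mul 2

end Averages

section FiniteMemory

variable {Ω E : Type*} [MeasurableSpace E] {e : ℤ → Ω → E} {b : ℤ → Ω → ℝ} {S S' : Set ℤ}

/-- The `σ`-algebra generated by `e s`, `s ∈ S`. -/
@[reducible] def sigmaOn (e : ℤ → Ω → E) (S : Set ℤ) : MeasurableSpace Ω :=
  ⨆ s : S, MeasurableSpace.comap (e s) inferInstance

theorem sigmaOn_mono (h : S ⊆ S') : sigmaOn e S ≤ sigmaOn e S' :=
  iSup_le fun s => le_iSup (fun s : S' => MeasurableSpace.comap (e s) inferInstance) ⟨s, h s.2⟩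

theorem measurable_sigmaOn {t : ℤ} (ht : t ∈ S) : Measurable[sigmaOn e S] (e t) :=
  Measurable.of_comap_le (le_iSup (fun s : S => MeasurableSpace.comap (e s) inferInstance) ⟨t, ht⟩)

theorem measurable_sigmaOn_memory_mono {J J' : ℕ} (hJ : J ≤ J') {t : ℤ} {f : Ω → ℝ}
    (hf : Measurable[sigmaOn e (Set.Icc (t - J) t)] f) :
    Measurable[sigmaOn e (Set.Icc (t - J') t)] f :=
  hf.mono (sigmaOn_mono (Set.Icc_subset_Icc_left (by omega))) le_rfl

/-- The algebra of uniformly bounded real processes whose value at time `t` is a function of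
`e (t - J), …, e t`, for some `J` that does not depend on `t`. -/
def finiteMemory (e : ℤ → Ω → E) : Subalgebra ℝ (ℤ → Ω → ℝ) where
  carrier := {b | ∃ (J : ℕ) (M : ℝ), (∀ t ω, |b t ω| ≤ M) ∧
    ∀ t, Measurable[sigmaOn e (Set.Icc (t - J) t)] (b t)}
  add_mem' := by
    rintro b b' ⟨J, M, hM, hJ⟩ ⟨J', M', hM', hJ'⟩
    refine ⟨max J J', M + M', fun t ω => ?_, fun t => ?_⟩
    · exact (abs_add_le _ _).trans (add_le_add (hM t ω) (hM' t ω))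
    · exact (measurable_sigmaOn_memory_mono (le_max_left J J') (hJ t)).add
        (measurable_sigmaOn_memory_mono (le_max_right J J') (hJ' t))
  mul_mem' := by
    rintro b b' ⟨J, M, hM, hJ⟩ ⟨J', M', hM', hJ'⟩
    refine ⟨max J J', M * M', fun t ω => ?_, fun t => ?_⟩
    · simp only [Pi.mul_apply, abs_mul]
      exact mul_le_mul (hM t ω) (hM' t ω) (abs_nonneg _) ((abs_nonneg _).trans (hM t ω))
    · exact (measurable_sigmaOn_memory_mono (le_max_left J J') (hJ t)).mul
        (measurable_sigmaOn_memory_mono (le_max_right J J') (hJ' t))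
  algebraMap_mem' c := ⟨0, |c|, fun _ _ => le_rfl, fun _ => measurable_const⟩

theorem shift_mem_finiteMemory (hb : b ∈ finiteMemory e) {s : ℤ} (hs : s ≤ 0) :
    (fun t => b (t + s)) ∈ finiteMemory e := by
  obtain ⟨J, M, hM, hJ⟩ := hb
  refine ⟨J + s.natAbs, M, fun t => hM _, fun t => (hJ (t + s)).mono (sigmaOn_mono ?_) le_rfl⟩
  exact Set.Icc_subset_Icc (by omega) (by omega)

theorem indicator_mem_finiteMemory {F : Type*} [NormedAddCommGroup F] [NormedSpace ℝ F]
    [MeasurableSpace F] [BorelSpace F] {e : ℤ → Ω → F} (l : F →L[ℝ] ℝ) (C : ℝ≥0) :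
    (fun t ω => {x | ‖x‖₊ < C}.indicator l (e t ω)) ∈ finiteMemory e := by
  refine ⟨0, ‖l‖ * C, fun t ω => ?_, fun t => (l.measurable.indicator
    (measurableSet_lt measurable_nnnorm measurable_const)).comp (measurable_sigmaOn (by simp))⟩
  by_cases h : ‖e t ω‖₊ < C
  · simpa [h] using l.le_opNorm_of_le (NNReal.coe_le_coe.2 h.le)
  · simpa [h] using by positivity

variable [mΩ : MeasurableSpace Ω]

theorem sigmaOn_le (he : ∀ t, Measurable (e t)) (S : Set ℤ) : sigmaOn e S ≤ mΩ :=
  iSup_le fun s => (he s).comap_le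

theorem measurable_of_mem_finiteMemory (he : ∀ t, Measurable (e t)) (hb : b ∈ finiteMemory e)
    (t : ℤ) : Measurable (b t) :=
  let ⟨_, _, _, hJ⟩ := hb
  (hJ t).mono (sigmaOn_le he _) le_rfl

variable {P : Measure Ω} [IsProbabilityMeasure P]

theorem memLp_of_mem_finiteMemory {p : ℝ≥0∞} (he : ∀ t, Measurable (e t))
    (hb : b ∈ finiteMemory e) (t : ℤ) : MemLp (b t) p P := by
  have hbm := (measurable_of_mem_finiteMemory he hb t).aestronglyMeasurable (μ := P)
  obtain ⟨_, M, hM, _⟩ := hb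
  exact .of_bound hbm M (ae_of_all _ (hM t))

theorem abs_real_inter_sub_le_one (A B : Set Ω) :
    |P.real (A ∩ B) - P.real A * P.real B| ≤ 1 :=
  abs_sub_le_of_nonneg_of_le measureReal_nonneg measureReal_le_one (by positivity)
    (mul_le_one₀ measureReal_le_one measureReal_nonneg measureReal_le_one)

theorem le_mixingCoeff {t : ℤ} {ℓ : ℕ} {A B : Set Ω}
    (hA : MeasurableSet[sigmaOn e (Set.Iic t)] A)
    (hB : MeasurableSet[sigmaOn e (Set.Ici (t + (ℓ : ℤ)))] B) :
    |P.real (A ∩ B) - P.real A * P.real B| ≤ mixingCoeff P e ℓ := by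
  refine le_csSup ⟨1, ?_⟩ ⟨t, A, B, hA, hB, rfl⟩
  rintro r ⟨t, A, B, -, -, rfl⟩
  exact abs_real_inter_sub_le_one A B

/-- At lags below the memory `J` the two windows overlap, and the trivial bound is used. -/
theorem exists_abs_covariance_le_of_mem_finiteMemory (he : ∀ t, Measurable (e t))
    (hmix : Tendsto (mixingCoeff P e) atTop (𝓝 0)) (hb : b ∈ finiteMemory e) :
    ∃ a : ℕ → ℝ, Tendsto a atTop (𝓝 0) ∧ ∀ s t, |cov[b s, b t; P]| ≤ a (s - t).natAbs := by
  obtain ⟨J, M, hM, hJ⟩ := hb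
  refine ⟨fun n => 4 * M * M * if n < J then 1 else mixingCoeff P e (n - J), ?_, fun s t => ?_⟩
  · have hlim : Tendsto (fun n => 4 * M * M * mixingCoeff P e (n - J)) atTop (𝓝 0) := by
      simpa only [mul_zero, Function.comp_apply] using
        (hmix.comp (tendsto_sub_atTop_nat J)).const_mul (4 * M * M)
    refine hlim.congr' ?_
    filter_upwards [eventually_ge_atTop J] with n hn
    rw [if_neg hn.not_gt]
  · wlog hst : s ≤ t generalizing s t
    · rw [covariance_comm, ← Int.natAbs_neg, neg_sub]
      exact this t s (le_of_not_ge hst)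
    beta_reduce
    split_ifs with h
    · exact abs_covariance_le_of_abs_le (sigmaOn_le he _) (sigmaOn_le he _) (hJ s) (hM s) (hJ t)
        (hM t) fun A B _ _ => abs_real_inter_sub_le_one A B
    · have hwindow : Set.Icc (t - J) t ⊆ Set.Ici (s + (((s - t).natAbs - J : ℕ) : ℤ)) := by
        intro r hr
        simp only [Set.mem_Icc, Set.mem_Ici] at hr ⊢
        omega
      exact abs_covariance_le_of_abs_le (sigmaOn_le he _) (sigmaOn_le he _)
        ((hJ s).mono (sigmaOn_mono Set.Icc_subset_Iic_self) le_rfl) (hM s)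
        ((hJ t).mono (sigmaOn_mono hwindow) le_rfl) (hM t) fun A B hA hB => le_mixingCoeff hA hB

end FiniteMemory

section Closure

theorem tendsto_zero_of_mem_topologicalClosure {E F : Type*} [NormedAddCommGroup E]
    [NormedSpace ℝ E] [NormedAddCommGroup F] [NormedSpace ℝ F] {f : ℕ → E →L[ℝ] F} {C : ℝ}
    (hf : ∀ n, ‖f n‖ ≤ C) {S : Submodule ℝ E} (hS : ∀ x ∈ S, Tendsto (f · x) atTop (𝓝 0)) {x : E}
    (hx : x ∈ S.topologicalClosure) : Tendsto (f · x) atTop (𝓝 0) := by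
  have hequi : Equicontinuous ((↑) ∘ f) := by
    have h := (NormedSpace.equicontinuous_TFAE f).out 5 1
    exact h.1 ⟨C, hf⟩
  exact closure_minimal hS (hequi.isClosed_setOfPred_tendsto (f := fun _ => 0) continuous_const) hx

variable {α E F G : Type*} [TopologicalSpace α] [NormedAddCommGroup E] [NormedSpace ℝ E]
  [NormedAddCommGroup F] [NormedSpace ℝ F] [NormedAddCommGroup G] [NormedSpace ℝ G]

/-- The pointwise application of a bounded bilinear map to bounded continuous functions. -/
def pointwise (B : E →L[ℝ] F →L[ℝ] G) : (α →ᵇ E) →L[ℝ] (α →ᵇ F) →L[ℝ] (α →ᵇ G) :=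
  LinearMap.mkContinuous₂
    (LinearMap.mk₂ ℝ
      (fun f g => .ofNormedAddCommGroup (fun x => B (f x) (g x)) (by fun_prop) (‖B‖ * ‖f‖ * ‖g‖)
        fun x => B.le_of_opNorm₂_le_of_le le_rfl (f.norm_coe_le_norm x) (g.norm_coe_le_norm x))
      (fun _ _ _ => by ext; simp) (fun _ _ _ => by ext; simp)
      (fun _ _ _ => by ext; simp) (fun _ _ _ => by ext; simp))
    ‖B‖ fun f g => BoundedContinuousFunction.norm_ofNormedAddCommGroup_le _ (by positivity)
      fun x => B.le_of_opNorm₂_le_of_le le_rfl (f.norm_coe_le_norm x) (g.norm_coe_le_norm x)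

theorem pointwise_apply (B : E →L[ℝ] F →L[ℝ] G) (f : α →ᵇ E) (g : α →ᵇ F) (x : α) :
    pointwise B f g x = B (f x) (g x) := rfl

end Closure

section Approximable

variable {Ω E : Type*} [MeasurableSpace Ω] {P : Measure Ω} [MeasurableSpace E] {e : ℤ → Ω → E}
  {p : ℝ≥0∞} [Fact (1 ≤ p)] {b v w : ℤ → Ω → ℝ} {V W : ℤ →ᵇ Lp ℝ p P}

/-- The processes in `finiteMemory e`, as bounded sequences in `L^p`. -/
def boundedMemory (P : Measure Ω) (e : ℤ → Ω → E) (p : ℝ≥0∞) [Fact (1 ≤ p)] :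
    Submodule ℝ (ℤ →ᵇ Lp ℝ p P) where
  carrier := {W | ∃ b ∈ finiteMemory e, ∀ t, W t =ᵐ[P] b t}
  zero_mem' := ⟨0, zero_mem _, fun _ => Lp.coeFn_zero ..⟩
  add_mem' := by
    rintro V W ⟨b, hb, hVb⟩ ⟨b', hb', hWb'⟩
    exact ⟨b + b', add_mem hb hb', fun t => (Lp.coeFn_add ..).trans ((hVb t).add (hWb' t))⟩
  smul_mem' := by
    rintro c V ⟨b, hb, hVb⟩
    exact ⟨c • b, Subalgebra.smul_mem _ hb c,
      fun t => (Lp.coeFn_smul ..).trans ((hVb t).const_smul c)⟩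

/-- The limits in `L^p`, uniformly in time, of bounded processes that are functions of finitely
many recent values of `e`. -/
def approximable (P : Measure Ω) (e : ℤ → Ω → E) (p : ℝ≥0∞) [Fact (1 ≤ p)] :
    Submodule ℝ (ℤ →ᵇ Lp ℝ p P) :=
  (boundedMemory P e p).topologicalClosure

theorem shift_mem_approximable (hW : W ∈ approximable P e p) {s : ℤ} (hs : s ≤ 0) :
    W.compContinuous ⟨(· + s), continuous_of_discreteTopology⟩ ∈ approximable P e p := by
  refine map_mem_closure (f := fun W : ℤ →ᵇ Lp ℝ p P => W.compContinuous _)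
    (BoundedContinuousFunction.continuous_compContinuous _) hW ?_
  rintro V ⟨b, hb, hVb⟩
  exact ⟨_, shift_mem_finiteMemory hb hs, fun t => hVb (t + s)⟩

theorem mul_mem_approximable {V W : ℤ →ᵇ Lp ℝ 2 P} (hV : V ∈ approximable P e 2)
    (hW : W ∈ approximable P e 2) :
    pointwise ((ContinuousLinearMap.mul ℝ ℝ).holderL P 2 2 1) V W ∈ approximable P e 1 := by
  refine map_mem_closure₂ (f := fun V W => pointwise _ V W) (by fun_prop) hV hW ?_
  rintro V ⟨b, hb, hVb⟩ W ⟨b', hb', hWb'⟩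
  refine ⟨b * b', mul_mem hb hb', fun t => ?_⟩
  have hmul := (ContinuousLinearMap.mul ℝ ℝ).coeFn_holder (r := 1) (f := V t) (g := W t)
  filter_upwards [hmul, hVb t, hWb' t] with ω hω hVω hWω
  rw [pointwise_apply, ContinuousLinearMap.holderL_apply_apply, hω, hVω, hWω]
  rfl

/-- The process `w`, up to modification at each time, belongs to `approximable P e p`. -/
def IsApproximable (P : Measure Ω) (e : ℤ → Ω → E) (p : ℝ≥0∞)
    [Fact (1 ≤ p)] (w : ℤ → Ω → ℝ) : Prop :=
  ∃ W ∈ approximable P e p, ∀ t, W t =ᵐ[P] w t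

theorem IsApproximable.add (hv : IsApproximable P e p v) (hw : IsApproximable P e p w) :
    IsApproximable P e p (v + w) := by
  obtain ⟨V, hV, hVv⟩ := hv
  obtain ⟨W, hW, hWw⟩ := hw
  exact ⟨V + W, add_mem hV hW, fun t => (Lp.coeFn_add _ _).trans ((hVv t).add (hWw t))⟩

theorem IsApproximable.mul (hv : IsApproximable P e 2 v) (hw : IsApproximable P e 2 w) :
    IsApproximable P e 1 (v * w) := by
  obtain ⟨V, hV, hVv⟩ := hv
  obtain ⟨W, hW, hWw⟩ := hw
  exact ⟨_, mul_mem_approximable hV hW, fun t =>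
    ((ContinuousLinearMap.mul ℝ ℝ).coeFn_holder (r := 1) _ _).trans ((hVv t).mul (hWw t))⟩

theorem IsApproximable.sum {κ : Type*} {s : Finset κ} {w : κ → ℤ → Ω → ℝ}
    (hw : ∀ i ∈ s, IsApproximable P e p (w i)) : IsApproximable P e p (∑ i ∈ s, w i) := by
  choose! W hW hWw using hw
  refine ⟨∑ i ∈ s, W i, sum_mem hW, fun t => ?_⟩
  rw [BoundedContinuousFunction.sum_apply, Finset.sum_apply]
  refine (Lp.coeFn_finsetSum _ _).trans ?_
  exact eventuallyEq_sum fun i hi => hWw i hi t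

variable [IsProbabilityMeasure P]

theorem exists_mem_boundedMemory (he : ∀ t, Measurable (e t)) (hb : b ∈ finiteMemory e) :
    ∃ W ∈ boundedMemory P e p, ∀ t, W t =ᵐ[P] b t := by
  have hLp : ∀ t, MemLp (b t) p P := memLp_of_mem_finiteMemory he hb
  obtain ⟨J, M, hM, hJ⟩ := hb
  obtain ⟨C, hC⟩ : ∃ C, ∀ t, ‖(hLp t).toLp‖ ≤ C := ⟨_, fun t => Lp.norm_le_of_ae_bound
    ((abs_nonneg _).trans (hM t P.nonempty_of_neZero.some))
    ((hLp t).coeFn_toLp.mono fun ω hω => hω ▸ hM t ω)⟩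
  exact ⟨.ofNormedAddCommGroupDiscrete _ C hC, ⟨b, ⟨J, M, hM, hJ⟩, fun t => (hLp t).coeFn_toLp⟩,
    fun t => (hLp t).coeFn_toLp⟩

theorem isApproximable_const (he : ∀ t, Measurable (e t)) (c : ℝ) :
    IsApproximable P e p fun _ _ => c :=
  let ⟨W, hW, hWc⟩ := exists_mem_boundedMemory he (algebraMap_mem (finiteMemory e) c)
  ⟨W, Submodule.le_topologicalClosure _ hW, hWc⟩

/-- Truncate at a level that makes the tails uniformly small. -/
theorem mem_approximable_of_uniformIntegrable {F : Type*} [NormedAddCommGroup F] [NormedSpace ℝ F]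
    [MeasurableSpace F] [BorelSpace F] {e : ℤ → Ω → F} (he : ∀ t, Measurable (e t)) (hp : p ≠ ∞)
    (hUI : UniformIntegrable e p P) (l : F →L[ℝ] ℝ)
    (hW : ∀ t, W t =ᵐ[P] fun ω => l (e t ω)) : W ∈ approximable P e p := by
  refine Metric.mem_closure_iff.2 fun r hr => ?_
  have hp0 : p ≠ 0 := (one_pos.trans_le (Fact.out : 1 ≤ p)).ne'
  obtain ⟨C, hC⟩ := hUI.spec hp0 hp (ε := r / (2 * (‖l‖ + 1))) (by positivity)
  obtain ⟨V, hV, hVe⟩ :=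
    exists_mem_boundedMemory (P := P) (p := p) he (indicator_mem_finiteMemory l C)
  refine ⟨V, hV, ?_⟩
  have htail : ∀ t, MemLp ({ω | C ≤ ‖e t ω‖₊}.indicator (e t)) p P := fun t =>
    (hUI.memLp t).indicator (measurableSet_le measurable_const (he t).nnnorm)
  have hdist : ∀ t, dist (W t) (V t) ≤ ‖l‖ * (r / (2 * (‖l‖ + 1))) := by
    intro t
    rw [dist_eq_norm]
    calc ‖W t - V t‖ ≤ ‖l‖ * ‖(htail t).toLp‖ := by
          refine Lp.norm_le_mul_norm_of_ae_le_mul ?_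
          filter_upwards [Lp.coeFn_sub (W t) (V t), hW t, hVe t, (htail t).coeFn_toLp]
            with ω hsub hWω hVω htω
          rw [hsub, Pi.sub_apply, hWω, hVω, htω]
          by_cases h : ‖e t ω‖₊ < C
          · simp [h]
          · simpa [h, not_lt.1 h] using l.le_opNorm (e t ω)
      _ ≤ ‖l‖ * (r / (2 * (‖l‖ + 1))) := by
          gcongr
          rw [Lp.norm_toLp]
          exact ENNReal.toReal_le_of_le_ofReal (by positivity) (hC t)
  calc dist W V ≤ ‖l‖ * (r / (2 * (‖l‖ + 1))) :=
        (BoundedContinuousFunction.dist_le (by positivity)).2 hdist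
    _ < r := by
        field_simp
        nlinarith [norm_nonneg l]

end Approximable

section LawOfLargeNumbers

variable {Ω E : Type*} [MeasurableSpace Ω] {P : Measure Ω} [MeasurableSpace E] {e : ℤ → Ω → E}

/-- The time average `(W 1 + ⋯ + W T) / T`. -/
def average (P : Measure Ω) (T : ℕ) : (ℤ →ᵇ Lp ℝ 1 P) →L[ℝ] Lp ℝ 1 P :=
  (T : ℝ)⁻¹ • ∑ t ∈ Finset.Icc 1 T, BoundedContinuousFunction.evalCLM ℝ (t : ℤ)

theorem average_apply (T : ℕ) (W : ℤ →ᵇ Lp ℝ 1 P) :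
    average P T W = (T : ℝ)⁻¹ • ∑ t ∈ Finset.Icc 1 T, W (t : ℤ) := by
  simp [average]

theorem coeFn_average (T : ℕ) {W : ℤ →ᵇ Lp ℝ 1 P} {b : ℤ → Ω → ℝ} (hWb : ∀ t, W t =ᵐ[P] b t) :
    average P T W =ᵐ[P] fun ω => (T : ℝ)⁻¹ * ∑ t ∈ Finset.Icc 1 T, b t ω := by
  rw [average_apply]
  filter_upwards [Lp.coeFn_smul (T : ℝ)⁻¹ (∑ t ∈ Finset.Icc 1 T, W (t : ℤ)),
    Lp.coeFn_finsetSum (Finset.Icc 1 T) fun t : ℕ => W t, ae_all_iff.2 hWb] with ω hs hsum hb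
  simp only [hs, Pi.smul_apply, hsum, Finset.sum_apply, hb, smul_eq_mul]

theorem norm_average_le (T : ℕ) : ‖average P T‖ ≤ 1 := by
  refine ContinuousLinearMap.opNorm_le_bound _ zero_le_one fun W => ?_
  rw [average_apply, norm_smul, norm_inv, Real.norm_natCast, one_mul]
  rcases T.eq_zero_or_pos with rfl | hT
  · simp
  · rw [inv_mul_le_iff₀ (by positivity)]
    have hsum : ‖∑ t ∈ Finset.Icc 1 T, W (t : ℤ)‖ ≤ ∑ _ ∈ Finset.Icc 1 T, ‖W‖ :=
      norm_sum_le_of_le _ fun t _ => W.norm_coe_le_norm (t : ℤ)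
    simpa using hsum

variable [IsProbabilityMeasure P]

/-- The operator `f ↦ f - E f`. -/
def center (P : Measure Ω) [IsProbabilityMeasure P] : Lp ℝ 1 P →L[ℝ] Lp ℝ 1 P :=
  .id ℝ _ - (Lp.constL 1 P ℝ).comp L1.integralCLM

theorem center_apply (f : Lp ℝ 1 P) : center P f = f - Lp.const 1 P (∫ ω, f ω ∂P) := by
  have h : L1.integralCLM f = ∫ ω, f ω ∂P :=
    (L1.integral_eq f).symm.trans (L1.integral_eq_integral f)
  simp only [center, sub_apply, ContinuousLinearMap.comp_apply, h]
  rfl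

theorem coeFn_center (f : Lp ℝ 1 P) : center P f =ᵐ[P] fun ω => f ω - P[f] := by
  rw [center_apply]
  filter_upwards [Lp.coeFn_sub f (Lp.const 1 P (P[f])), Lp.coeFn_const 1 P (P[f])] with ω hs hc
  rw [hs, Pi.sub_apply, hc, Function.const_apply]

theorem integral_abs_sub_integral_le_sqrt_variance {X : Ω → ℝ} (hX : MemLp X 2 P) :
    ∫ ω, |X ω - P[X]| ∂P ≤ √Var[X; P] := by
  have hc : MemLp (fun ω => |X ω - P[X]|) 2 P := (hX.sub (memLp_const _)).abs
  have h := variance_nonneg (fun ω => |X ω - P[X]|) P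
  rw [variance_eq_sub hc] at h
  simp only [Pi.pow_apply, sq_abs] at h
  rw [variance_eq_integral hX.aemeasurable]
  exact Real.le_sqrt_of_sq_le (sub_nonneg.1 h)

theorem norm_center_le_sqrt_variance {f : Lp ℝ 1 P} {X : Ω → ℝ} (hX : MemLp X 2 P)
    (hf : f =ᵐ[P] X) : ‖center P f‖ ≤ √Var[X; P] := by
  refine le_trans (le_of_eq ?_) (integral_abs_sub_integral_le_sqrt_variance hX)
  rw [L1.norm_eq_integral_norm]
  refine integral_congr_ae ?_
  filter_upwards [coeFn_center f, hf] with ω hc hω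
  rw [hc, hω, integral_congr_ae hf, Real.norm_eq_abs]

theorem tendsto_center_average (he : ∀ t, Measurable (e t))
    (hmix : Tendsto (mixingCoeff P e) atTop (𝓝 0)) {W : ℤ →ᵇ Lp ℝ 1 P}
    (hW : W ∈ approximable P e 1) :
    Tendsto (fun T => center P (average P T W)) atTop (𝓝 0) := by
  have hnorm : ∀ T, ‖(center P).comp (average P T)‖ ≤ ‖center P‖ := fun T =>
    ((center P).opNorm_comp_le _).trans (mul_le_of_le_one_right (norm_nonneg _) (norm_average_le T))
  refine tendsto_zero_of_mem_topologicalClosure hnorm ?_ hW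
  rintro V ⟨b, hb, hVb⟩
  have hbL : ∀ t, MemLp (b t) 2 P := memLp_of_mem_finiteMemory he hb
  obtain ⟨a, ha, hcov⟩ := exists_abs_covariance_le_of_mem_finiteMemory he hmix hb
  have hvar : Tendsto (fun T : ℕ => √Var[fun ω => (T : ℝ)⁻¹ * ∑ t ∈ Finset.Icc 1 T, b t ω; P])
      atTop (𝓝 0) := by
    simpa only [Real.sqrt_zero] using (tendsto_variance_average hbL ha hcov).sqrt
  refine squeeze_zero_norm (fun T => norm_center_le_sqrt_variance ?_ (coeFn_average T hVb)) hvar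
  exact (memLp_finsetSum _ fun (t : ℕ) _ => hbL t).const_mul _

theorem IsApproximable.tendstoInMeasure_average {w : ℤ → Ω → ℝ} (he : ∀ t, Measurable (e t))
    (hmix : Tendsto (mixingCoeff P e) atTop (𝓝 0)) (hw : IsApproximable P e 1 w) {c : ℝ}
    (hc : ∀ t, ∫ ω, w t ω ∂P = c) :
    TendstoInMeasure P (fun (T : ℕ) ω => (T : ℝ)⁻¹ * ∑ t ∈ Finset.Icc 1 T, w t ω) atTop
      fun _ => c := by
  obtain ⟨W, hW, hWw⟩ := hw
  have hw : ∀ t, Integrable (w t) P := fun t => (L1.integrable_coeFn (W t)).congr (hWw t)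
  have hmean : ∀ T : ℕ, 1 ≤ T → P[average P T W] = c := by
    intro T hT
    rw [integral_congr_ae (coeFn_average T hWw), integral_const_mul,
      integral_finsetSum _ fun (t : ℕ) _ => hw t]
    simp only [hc, Finset.sum_const, Nat.card_Icc, Nat.add_sub_cancel, nsmul_eq_mul]
    field_simp
  have h : TendstoInMeasure P (fun T => center P (average P T W)) atTop (0 : Lp ℝ 1 P) :=
    tendstoInMeasure_of_tendsto_Lp (tendsto_center_average he hmix hW)
  rw [tendstoInMeasure_iff_dist] at h ⊢
  refine fun r hr => (h r hr).congr' ?_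
  filter_upwards [eventually_ge_atTop 1] with T hT
  refine measure_congr ?_
  filter_upwards [coeFn_center (average P T W), coeFn_average T hWw, Lp.coeFn_zero ℝ 1 P]
    with ω hcenter havg hzero
  rw [eq_iff_iff]
  change r ≤ dist _ _ ↔ r ≤ dist _ _
  rw [hcenter, hzero, hmean T hT, havg, Pi.zero_apply, dist_zero_right, Real.dist_eq,
    Real.norm_eq_abs]

end LawOfLargeNumbers

section ClosedSpan

theorem map_mem_of_mem_topologicalClosure_span {𝕜 E F : Type*} [NontriviallyNormedField 𝕜]
    [NormedAddCommGroup E] [NormedSpace 𝕜 E] [NormedAddCommGroup F] [NormedSpace 𝕜 F]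
    {s : Set E} {K : Submodule 𝕜 F} (hK : IsClosed (K : Set F)) (f : E →L[𝕜] F)
    (h : ∀ v ∈ s, f v ∈ K) {v : E} (hv : v ∈ (Submodule.span 𝕜 s).topologicalClosure) :
    f v ∈ K :=
  Submodule.topologicalClosure_minimal (t := K.comap f.toLinearMap) _ (Submodule.span_le.2 h)
    (hK.preimage f.continuous) hv

end ClosedSpan

section Wold

variable {𝕜 H : Type*} [RCLike 𝕜] [NormedAddCommGroup H] [InnerProductSpace 𝕜 H] [CompleteSpace H]
  {𝓐 : StarSubalgebra 𝕜 (H →L[𝕜] H)}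

/-- The closed linear span of the vectors `ζ s`, `s ∈ S`, with coefficients in the operator algebra
`𝓐` instead of the scalars. The space `closedSpan` is the case in which `H = L²(Ω; ℝ^ι)` and `𝓐`
consists of the constant matrices. -/
def opSpan {τ : Type*} (𝓐 : StarSubalgebra 𝕜 (H →L[𝕜] H)) (ζ : τ → H) (S : Set τ) :
    Submodule 𝕜 H :=
  (Submodule.span 𝕜 {v | ∃ s ∈ S, ∃ A ∈ 𝓐, A (ζ s) = v}).topologicalClosure

instance {τ : Type*} (ζ : τ → H) (S : Set τ) : (opSpan 𝓐 ζ S).HasOrthogonalProjection :=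
  inferInstanceAs (Submodule.topologicalClosure _).HasOrthogonalProjection

section OpSpan

variable {τ : Type*} {ζ : τ → H} {S S' : Set τ}

theorem opSpan_mono (h : S ⊆ S') : opSpan 𝓐 ζ S ≤ opSpan 𝓐 ζ S' :=
  Submodule.topologicalClosure_mono <| Submodule.span_mono fun _ ⟨s, hs, hv⟩ => ⟨s, h hs, hv⟩

theorem isClosed_opSpan : IsClosed (opSpan 𝓐 ζ S : Set H) :=
  Submodule.isClosed_topologicalClosure _

theorem map_apply_mem_opSpan {s : τ} (hs : s ∈ S) {A : H →L[𝕜] H} (hA : A ∈ 𝓐) :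
    A (ζ s) ∈ opSpan 𝓐 ζ S :=
  Submodule.le_topologicalClosure _ (Submodule.subset_span ⟨s, hs, A, hA, rfl⟩)

theorem apply_mem_opSpan {s : τ} (hs : s ∈ S) : ζ s ∈ opSpan 𝓐 ζ S :=
  map_apply_mem_opSpan hs (one_mem 𝓐)

theorem map_mem_of_mem_opSpan {F : Type*} [NormedAddCommGroup F] [NormedSpace 𝕜 F]
    {K : Submodule 𝕜 F} (hK : IsClosed (K : Set F)) (f : H →L[𝕜] F)
    (h : ∀ s ∈ S, ∀ A ∈ 𝓐, f (A (ζ s)) ∈ K) {v : H} (hv : v ∈ opSpan 𝓐 ζ S) : f v ∈ K := by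
  refine map_mem_of_mem_topologicalClosure_span hK f ?_ hv
  rintro _ ⟨s, hs, A, hA, rfl⟩
  exact h s hs A hA

theorem opSpan_le {K : Submodule 𝕜 H} (hK : IsClosed (K : Set H))
    (h : ∀ s ∈ S, ∀ A ∈ 𝓐, A (ζ s) ∈ K) : opSpan 𝓐 ζ S ≤ K := fun _ =>
  map_mem_of_mem_opSpan hK (.id 𝕜 H) h

theorem map_mem_opSpan {A : H →L[𝕜] H} (hA : A ∈ 𝓐) {v : H} (hv : v ∈ opSpan 𝓐 ζ S) :
    A v ∈ opSpan 𝓐 ζ S :=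
  map_mem_of_mem_opSpan isClosed_opSpan A
    (fun _ hs _ hB => map_apply_mem_opSpan hs (mul_mem hA hB)) hv

theorem mem_orthogonal_opSpan_iff {v : H} :
    v ∈ (opSpan 𝓐 ζ S)ᗮ ↔ ∀ s ∈ S, ∀ A ∈ 𝓐, ⟪A (ζ s), v⟫_𝕜 = 0 := by
  refine ⟨fun h s hs A hA => h _ (map_apply_mem_opSpan hs hA), fun h => ?_⟩
  have hle : opSpan 𝓐 ζ S ≤ (Submodule.span 𝕜 {v})ᗮ :=
    opSpan_le (Submodule.isClosed_orthogonal _) fun s hs A hA =>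
      Submodule.mem_orthogonal_singleton_iff_inner_left.2 (h s hs A hA)
  exact fun w hw => Submodule.mem_orthogonal_singleton_iff_inner_left.1 (hle hw)

theorem map_mem_orthogonal_opSpan {A : H →L[𝕜] H} (hA : A ∈ 𝓐) {v : H}
    (hv : v ∈ (opSpan 𝓐 ζ S)ᗮ) : A v ∈ (opSpan 𝓐 ζ S)ᗮ := by
  refine mem_orthogonal_opSpan_iff.2 fun s hs B hB => ?_
  rw [← ContinuousLinearMap.adjoint_inner_left]
  exact hv _ (map_mem_opSpan (star_mem hA) (map_apply_mem_opSpan hs hB))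

end OpSpan

/-- The innovation of `ζ` at time `t`: its deviation from the best linear prediction given the
strict past. -/
def innov (𝓐 : StarSubalgebra 𝕜 (H →L[𝕜] H)) (ζ : ℤ → H) (t : ℤ) : H :=
  ζ t - (opSpan 𝓐 ζ (Set.Iic (t - 1))).starProjection (ζ t)

section Innovations

variable {ζ : ℤ → H}

theorem innov_mem_opSpan (t : ℤ) : innov 𝓐 ζ t ∈ opSpan 𝓐 ζ (Set.Iic t) :=
  sub_mem (apply_mem_opSpan Set.self_mem_Iic) <|
    opSpan_mono (Set.Iic_subset_Iic.2 (sub_one_lt t).le) (Submodule.starProjection_apply_mem _ _)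

theorem innov_mem_orthogonal (t : ℤ) : innov 𝓐 ζ t ∈ (opSpan 𝓐 ζ (Set.Iic (t - 1)))ᗮ :=
  Submodule.sub_starProjection_mem_orthogonal _

theorem mem_opSpan_sub_one {v : H} {t : ℤ} (hv : v ∈ opSpan 𝓐 ζ (Set.Iic t))
    (h : ∀ A ∈ 𝓐, ⟪A (innov 𝓐 ζ t), v⟫_𝕜 = 0) : v ∈ opSpan 𝓐 ζ (Set.Iic (t - 1)) := by
  set p := (opSpan 𝓐 ζ (Set.Iic (t - 1))).starProjection v
  have hp : p ∈ opSpan 𝓐 ζ (Set.Iic (t - 1)) :=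
    Submodule.starProjection_apply_mem _ v
  have hwp : v - p ∈ (opSpan 𝓐 ζ (Set.Iic (t - 1)))ᗮ :=
    Submodule.sub_starProjection_mem_orthogonal v
  have hw : v - p ∈ opSpan 𝓐 ζ (Set.Iic t) :=
    sub_mem hv (opSpan_mono (Set.Iic_subset_Iic.2 (sub_one_lt t).le) hp)
  have hw' : v - p ∈ (opSpan 𝓐 ζ (Set.Iic t))ᗮ := by
    refine mem_orthogonal_opSpan_iff.2 fun s hs A hA => ?_
    rcases (Set.mem_Iic.1 hs).lt_or_eq with hst | rfl
    · exact mem_orthogonal_opSpan_iff.1 hwp s (Int.le_sub_one_of_lt hst) A hA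
    · have hinnov : ⟪A (innov 𝓐 ζ s), v - p⟫_𝕜 = 0 := by
        rw [inner_sub_right, h A hA, zero_sub, neg_eq_zero]
        exact Submodule.inner_left_of_mem_orthogonal hp
          (map_mem_orthogonal_opSpan hA (innov_mem_orthogonal s))
      have hpred : ⟪A (ζ s - innov 𝓐 ζ s), v - p⟫_𝕜 = 0 := by
        rw [innov, sub_sub_cancel]
        exact Submodule.inner_right_of_mem_orthogonal
          (map_mem_opSpan hA (Submodule.starProjection_apply_mem _ _)) hwp
      rwa [map_sub, inner_sub_left, hinnov, sub_zero] at hpred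
  have hvp : v - p = 0 :=
    inner_self_eq_zero.1 (Submodule.inner_right_of_mem_orthogonal hw hw')
  exact sub_eq_zero.1 hvp ▸ hp

/-- A vector of `opSpan 𝓐 ζ (Iic t)` orthogonal to all innovations up to `t` recedes into the
remote past. -/
theorem opSpan_innov (h : ⨅ t, opSpan 𝓐 ζ (Set.Iic t) = ⊥) (t : ℤ) :
    opSpan 𝓐 (innov 𝓐 ζ) (Set.Iic t) = opSpan 𝓐 ζ (Set.Iic t) := by
  have hle : opSpan 𝓐 (innov 𝓐 ζ) (Set.Iic t) ≤ opSpan 𝓐 ζ (Set.Iic t) :=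
    opSpan_le isClosed_opSpan fun s hs A hA =>
      map_mem_opSpan hA (opSpan_mono (Set.Iic_subset_Iic.2 hs) (innov_mem_opSpan s))
  have hbot : (opSpan 𝓐 (innov 𝓐 ζ) (Set.Iic t))ᗮ ⊓ opSpan 𝓐 ζ (Set.Iic t) = ⊥ := by
    refine eq_bot_iff.2 fun v ⟨hv, hvt⟩ => h ▸ (Submodule.mem_iInf _).2 fun s => ?_
    have hback : ∀ n : ℕ, v ∈ opSpan 𝓐 ζ (Set.Iic (t - n)) := by
      intro n
      induction n with
      | zero => simpa using hvt
      | succ n ih =>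
        have := mem_opSpan_sub_one ih fun A hA =>
          mem_orthogonal_opSpan_iff.1 hv (t - n) (by simp) A hA
        simpa [sub_sub] using this
    exact opSpan_mono (Set.Iic_subset_Iic.2 (by omega)) (hback (t - s).toNat)
  rw [← Submodule.sup_orthogonal_inf_of_hasOrthogonalProjection hle, hbot, sup_bot_eq]

end Innovations

/-- `A`-filtered shift of a process: `V ↦ (A (V (t + s)))_t`. -/
def lag (A : H →L[𝕜] H) (s : ℤ) : (ℤ →ᵇ H) →L[𝕜] (ℤ →ᵇ H) :=
  (A.compLeftContinuousBounded ℤ).comp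
    (BoundedContinuousFunction.compContinuousCLM H 𝕜 ⟨(· + s), continuous_of_discreteTopology⟩)

omit [CompleteSpace H] in
@[simp]
theorem lag_apply (A : H →L[𝕜] H) (s : ℤ) (V : ℤ →ᵇ H) (t : ℤ) : lag A s V t = A (V (t + s)) :=
  rfl

/-- The closure, uniformly in time, of the finite filters `t ↦ ∑ A_s ζ (t + s)`, `s ∈ S`, with
coefficients in `𝓐`. -/
def filterSpan (𝓐 : StarSubalgebra 𝕜 (H →L[𝕜] H)) (ζ : ℤ →ᵇ H) (S : Set ℤ) :
    Submodule 𝕜 (ℤ →ᵇ H) :=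
  (Submodule.span 𝕜 {V | ∃ s ∈ S, ∃ A ∈ 𝓐, lag A s ζ = V}).topologicalClosure

/-- Second-order stationarity relative to `𝓐`: the inner products `⟪ζ s, A ζ r⟫`, `A ∈ 𝓐`, are
invariant under a common time shift. -/
def IsOpStationary (𝓐 : StarSubalgebra 𝕜 (H →L[𝕜] H)) (ζ : ℤ → H) : Prop :=
  ∀ A ∈ 𝓐, ∀ s r t : ℤ, ⟪ζ (t + s), A (ζ (t + r))⟫_𝕜 = ⟪ζ s, A (ζ r)⟫_𝕜

theorem IsOpStationary.norm_eq {ζ : ℤ → H} (h : IsOpStationary 𝓐 ζ) (t : ℤ) : ‖ζ t‖ = ‖ζ 0‖ := by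
  have hinner : ⟪ζ t, ζ t⟫_𝕜 = ⟪ζ 0, ζ 0⟫_𝕜 := by simpa using h 1 (one_mem 𝓐) 0 0 t
  rw [norm_eq_sqrt_re_inner (𝕜 := 𝕜), hinner, ← norm_eq_sqrt_re_inner]

section Filters

variable {ζ V W : ℤ →ᵇ H} {S S' : Set ℤ}

theorem filterSpan_mono (h : S ⊆ S') : filterSpan 𝓐 ζ S ≤ filterSpan 𝓐 ζ S' :=
  Submodule.topologicalClosure_mono <| Submodule.span_mono fun _ ⟨s, hs, hv⟩ => ⟨s, h hs, hv⟩

theorem isClosed_filterSpan : IsClosed (filterSpan 𝓐 ζ S : Set (ℤ →ᵇ H)) :=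
  Submodule.isClosed_topologicalClosure _

theorem lag_mem_filterSpan {s : ℤ} (hs : s ∈ S) {A : H →L[𝕜] H} (hA : A ∈ 𝓐) :
    lag A s ζ ∈ filterSpan 𝓐 ζ S :=
  Submodule.le_topologicalClosure _ (Submodule.subset_span ⟨s, hs, A, hA, rfl⟩)

theorem self_mem_filterSpan : ζ ∈ filterSpan 𝓐 ζ Set.univ := by
  convert lag_mem_filterSpan (ζ := ζ) (Set.mem_univ 0) (one_mem 𝓐)
  ext t
  simp

theorem map_mem_of_mem_filterSpan {F : Type*} [NormedAddCommGroup F] [NormedSpace 𝕜 F]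
    {K : Submodule 𝕜 F} (hK : IsClosed (K : Set F)) (f : (ℤ →ᵇ H) →L[𝕜] F)
    (h : ∀ s ∈ S, ∀ A ∈ 𝓐, f (lag A s ζ) ∈ K) (hV : V ∈ filterSpan 𝓐 ζ S) : f V ∈ K := by
  refine map_mem_of_mem_topologicalClosure_span hK f ?_ hV
  rintro _ ⟨s, hs, A, hA, rfl⟩
  exact h s hs A hA

theorem map_lag_mem_filterSpan (hV : V ∈ filterSpan 𝓐 ζ Set.univ) {A : H →L[𝕜] H} (hA : A ∈ 𝓐)
    (s : ℤ) : lag A s V ∈ filterSpan 𝓐 ζ Set.univ := by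
  refine map_mem_of_mem_filterSpan isClosed_filterSpan (lag A s) (fun r _ B hB => ?_) hV
  convert lag_mem_filterSpan (ζ := ζ) (Set.mem_univ (s + r)) (mul_mem hA hB) using 1
  ext t
  simp [add_assoc]

theorem filterSpan_le_of_mem (hV : V ∈ filterSpan 𝓐 ζ Set.univ) :
    filterSpan 𝓐 V S ≤ filterSpan 𝓐 ζ Set.univ := fun _ =>
  map_mem_of_mem_filterSpan isClosed_filterSpan (.id 𝕜 _) fun s _ _ hA =>
    map_lag_mem_filterSpan hV hA s

theorem apply_mem_opSpan_of_mem_filterSpan {r : ℤ} (hV : V ∈ filterSpan 𝓐 ζ (Set.Iic r)) (t : ℤ) :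
    V t ∈ opSpan 𝓐 ζ (Set.Iic (t + r)) := by
  have hlag : ∀ s ∈ Set.Iic r, ∀ A ∈ 𝓐,
      BoundedContinuousFunction.evalCLM 𝕜 t (lag A s ζ) ∈ opSpan 𝓐 ζ (Set.Iic (t + r)) := by
    intro s hs A hA
    rw [BoundedContinuousFunction.evalCLM_apply, lag_apply]
    have hts : t + s ∈ Set.Iic (t + r) := Set.mem_Iic.2 (add_le_add_right (Set.mem_Iic.1 hs) t)
    exact map_apply_mem_opSpan hts hA
  have := map_mem_of_mem_filterSpan isClosed_opSpan _ hlag hV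
  rwa [BoundedContinuousFunction.evalCLM_apply] at this

theorem IsOpStationary.inner_apply_eq (h : IsOpStationary 𝓐 ζ) (hV : V ∈ filterSpan 𝓐 ζ Set.univ)
    (hW : W ∈ filterSpan 𝓐 ζ Set.univ) (t : ℤ) : ⟪V t, W t⟫_𝕜 = ⟪V 0, W 0⟫_𝕜 := by
  have extend : ∀ V : ℤ →ᵇ H,
      (∀ s, ∀ A ∈ 𝓐, ⟪V t, lag A s ζ t⟫_𝕜 = ⟪V 0, lag A s ζ 0⟫_𝕜) →
      ∀ W ∈ filterSpan 𝓐 ζ Set.univ, ⟪V t, W t⟫_𝕜 = ⟪V 0, W 0⟫_𝕜 := by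
    intro V hV W hW
    exact sub_eq_zero.1 (map_mem_of_mem_filterSpan (K := ⊥) isClosed_singleton
      ((innerSL 𝕜 (V t)).comp (BoundedContinuousFunction.evalCLM 𝕜 t)
        - (innerSL 𝕜 (V 0)).comp (BoundedContinuousFunction.evalCLM 𝕜 0))
      (fun s _ A hA => sub_eq_zero.2 (hV s A hA)) hW)
  refine extend V (fun s A hA => ?_) W hW
  rw [← inner_conj_symm, extend (lag A s ζ) (fun r B hB => ?_) V hV, inner_conj_symm]
  have := h (star A * B) (mul_mem (star_mem hA) hB) s r t
  simpa [ContinuousLinearMap.star_eq_adjoint, ContinuousLinearMap.adjoint_inner_right] using this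

theorem IsOpStationary.of_mem_filterSpan (h : IsOpStationary 𝓐 ζ)
    (hV : V ∈ filterSpan 𝓐 ζ Set.univ) : IsOpStationary 𝓐 V := by
  intro A hA s r t
  simpa using h.inner_apply_eq (map_lag_mem_filterSpan hV (one_mem 𝓐) s)
    (map_lag_mem_filterSpan hV hA r) t

/-- Evaluation at time `0` is isometric on `filterSpan`, so its range is closed. -/
theorem IsOpStationary.exists_mem_filterSpan (h : IsOpStationary 𝓐 ζ) {v : H}
    (hv : v ∈ opSpan 𝓐 ζ S) : ∃ V ∈ filterSpan 𝓐 ζ S, V 0 = v := by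
  let ev : filterSpan 𝓐 ζ S →L[𝕜] H :=
    (BoundedContinuousFunction.evalCLM 𝕜 0).comp (filterSpan 𝓐 ζ S).subtypeL
  have hev : Isometry ev := AddMonoidHomClass.isometry_of_norm ev fun V => by
    have hV := (h.of_mem_filterSpan (filterSpan_mono S.subset_univ V.2)).norm_eq
    refine le_antisymm ((V : ℤ →ᵇ H).norm_coe_le_norm 0) ?_
    exact (BoundedContinuousFunction.norm_le (norm_nonneg _)).2 fun t => (hV t).le
  have : CompleteSpace (filterSpan 𝓐 ζ S) := isClosed_filterSpan.completeSpace_coe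
  have hle : opSpan 𝓐 ζ S ≤ ev.range := by
    refine opSpan_le hev.isClosedEmbedding.isClosed_range fun s hs A hA => ?_
    exact ⟨⟨_, lag_mem_filterSpan hs hA⟩, by simp [ev]⟩
  obtain ⟨V, hV⟩ := hle hv
  exact ⟨V, V.2, hV⟩

/-- By stationarity, the filter that predicts at time `0` predicts at all times. -/
theorem IsOpStationary.exists_innov_mem_filterSpan (h : IsOpStationary 𝓐 ζ) :
    ∃ ε ∈ filterSpan 𝓐 ζ Set.univ, ⇑ε = innov 𝓐 ζ := by
  obtain ⟨V, hV, hV0⟩ := h.exists_mem_filterSpan (S := Set.Iic (-1))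
    (Submodule.starProjection_apply_mem (opSpan 𝓐 ζ (Set.Iic (-1))) (ζ 0))
  have hVu := filterSpan_mono (Set.subset_univ _) hV
  have hdiff := sub_mem self_mem_filterSpan hVu
  refine ⟨ζ - V, hdiff, funext fun t => congrArg (ζ t - ·) ?_⟩
  refine (Submodule.eq_starProjection_of_mem_orthogonal
    (apply_mem_opSpan_of_mem_filterSpan hV t)
    (mem_orthogonal_opSpan_iff.2 fun s hs A hA => ?_)).symm
  have hshift := h.inner_apply_eq (lag_mem_filterSpan (Set.mem_univ (s - t)) hA) hdiff t
  have hs' : s - t ∈ Set.Iic (-1) := by simp only [Set.mem_Iic] at hs ⊢; omega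
  have horth : ⟪A (ζ (s - t)), ζ 0 - V 0⟫_𝕜 = 0 :=
    hV0 ▸ Submodule.sub_starProjection_mem_orthogonal (ζ 0) _ (map_apply_mem_opSpan hs' hA)
  simpa [horth] using hshift

/-- The Wold decomposition, with convergence uniform in time. -/
theorem IsOpStationary.mem_filterSpan_innov (h : IsOpStationary 𝓐 ζ)
    (hpnd : ⨅ t, opSpan 𝓐 ζ (Set.Iic t) = ⊥) {ε : ℤ →ᵇ H} (hε : ⇑ε = innov 𝓐 ζ) :
    ζ ∈ filterSpan 𝓐 ε (Set.Iic 0) := by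
  obtain ⟨ε', hε'ζ, hε'⟩ := h.exists_innov_mem_filterSpan
  obtain rfl : ε = ε' := DFunLike.coe_injective (hε.trans hε'.symm)
  have hζ0 : ζ 0 ∈ opSpan 𝓐 ε (Set.Iic 0) := by
    rw [hε, opSpan_innov hpnd]
    exact apply_mem_opSpan Set.self_mem_Iic
  obtain ⟨V, hV, hV0⟩ := (h.of_mem_filterSpan hε'ζ).exists_mem_filterSpan hζ0
  have hdiff := sub_mem self_mem_filterSpan (filterSpan_le_of_mem hε'ζ hV)
  have hVζ : ζ = V := by
    ext t
    have := (h.of_mem_filterSpan hdiff).norm_eq t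
    simpa [hV0, sub_eq_zero] using this
  exact hVζ ▸ hV

end Filters

end Wold

section UniformIntegrability

theorem uniformIntegrable_of_eLpNorm_le {α ι E : Type*} [MeasurableSpace α] {μ : Measure α}
    [IsFiniteMeasure μ] [NormedAddCommGroup E] {f : ι → α → E} {p q : ℝ≥0∞} (hp : p ≠ 0)
    (hpq : p < q) (hf : ∀ i, AEStronglyMeasurable (f i) μ) {C : ℝ≥0}
    (hC : ∀ i, eLpNorm (f i) q μ ≤ C) : UniformIntegrable f p μ := by
  have hr : 0 < 1 / p.toReal - 1 / q.toReal := by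
    rw [sub_pos, one_div, one_div, ← ENNReal.toReal_inv, ← ENNReal.toReal_inv]
    exact ENNReal.toReal_strict_mono (ENNReal.inv_ne_top.2 hp) (ENNReal.inv_lt_inv.2 hpq)
  have holder : ∀ i s, MeasurableSet s → eLpNorm (s.indicator (f i)) p μ
      ≤ C * μ s ^ (1 / p.toReal - 1 / q.toReal) := by
    intro i s hs
    calc eLpNorm (s.indicator (f i)) p μ
        ≤ eLpNorm (f i) q (μ.restrict s) * μ s ^ (1 / p.toReal - 1 / q.toReal) := by
          rw [eLpNorm_indicator_eq_eLpNorm_restrict hs]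
          simpa using eLpNorm_le_eLpNorm_mul_rpow_measure_univ hpq.le (hf i).restrict
      _ ≤ C * μ s ^ (1 / p.toReal - 1 / q.toReal) := by
          gcongr
          exact (eLpNorm_restrict_le ..).trans (hC i)
  refine ⟨hf, fun r hr0 => ?_, ?_⟩
  · have hlim : Tendsto (fun d : ℝ => C * ENNReal.ofReal d ^ (1 / p.toReal - 1 / q.toReal))
        (𝓝[>] 0) (𝓝 0) := by
      have hpow : Tendsto (fun d : ℝ => ENNReal.ofReal d ^ (1 / p.toReal - 1 / q.toReal))
          (𝓝[>] 0) (𝓝 0) := by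
        have h := (ENNReal.continuous_rpow_const (y := 1 / p.toReal - 1 / q.toReal)).tendsto 0
        rw [ENNReal.zero_rpow_of_pos hr] at h
        exact h.comp ((by simpa using ENNReal.tendsto_ofReal (tendsto_id (x := 𝓝 (0 : ℝ))) :
          Tendsto ENNReal.ofReal (𝓝 0) (𝓝 0)).mono_left nhdsWithin_le_nhds)
      simpa using ENNReal.Tendsto.const_mul hpow (.inr ENNReal.coe_ne_top)
    obtain ⟨d, hd, hd0⟩ := ((hlim.eventually_le_const (ENNReal.ofReal_pos.2 hr0)).and
      self_mem_nhdsWithin).exists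
    exact ⟨d, hd0, fun i s hs hsd => (holder i s hs).trans (le_trans (by gcongr) hd)⟩
  · refine ⟨C * (μ Set.univ ^ (1 / p.toReal - 1 / q.toReal)).toNNReal, fun i => ?_⟩
    rw [ENNReal.coe_mul, ENNReal.coe_toNNReal (by finiteness)]
    simpa using holder i _ MeasurableSet.univ

end UniformIntegrability

section ConstantOperators

variable {Ω E : Type*} [MeasurableSpace Ω] {P : Measure Ω} [NormedAddCommGroup E]
  [InnerProductSpace ℝ E] [CompleteSpace E]

/-- The pointwise action of the operators of `E` on `L²(Ω; E)`. -/
def pointwiseAction (P : Measure Ω) : (E →L[ℝ] E) →⋆ₐ[ℝ] (Lp E 2 P →L[ℝ] Lp E 2 P) where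
  toFun A := A.compLpL 2 P
  map_one' := by
    ext1 f
    exact Lp.ext (ContinuousLinearMap.coeFn_compLpL 1 f)
  map_mul' A B := by
    ext1 f
    refine Lp.ext ?_
    filter_upwards [(A * B).coeFn_compLpL f, A.coeFn_compLpL (B.compLpL 2 P f), B.coeFn_compLpL f]
      with ω hAB hA hB
    rw [hAB, mul_apply_eq_comp, mul_apply_eq_comp, hA, hB]
  map_zero' := by
    ext1 f
    refine Lp.ext ?_
    filter_upwards [(0 : E →L[ℝ] E).coeFn_compLpL f, Lp.coeFn_zero E 2 P] with ω h h0
    rw [h, zero_apply, zero_apply, h0, Pi.zero_apply]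
  map_add' A B := A.add_compLpL B
  commutes' c := by
    ext1 f
    refine Lp.ext ?_
    filter_upwards [(algebraMap ℝ (E →L[ℝ] E) c).coeFn_compLpL f, Lp.coeFn_smul c f] with ω h hs
    rw [h, ContinuousLinearMap.algebraMap_apply, ContinuousLinearMap.algebraMap_apply, hs,
      Pi.smul_apply]
  map_star' A := by
    refine (ContinuousLinearMap.eq_adjoint_iff _ _).2 fun f g => ?_
    rw [L2.inner_def, L2.inner_def]
    refine integral_congr_ae ?_
    filter_upwards [(star A).coeFn_compLpL f, A.coeFn_compLpL g] with ω hf hg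
    rw [hf, hg, ContinuousLinearMap.star_eq_adjoint, ContinuousLinearMap.adjoint_inner_left]

theorem coeFn_pointwiseAction (A : E →L[ℝ] E) (f : Lp E 2 P) :
    pointwiseAction P A f =ᵐ[P] fun ω => A (f ω) :=
  A.coeFn_compLpL f

/-- The constant operators of `E`, as an algebra of operators on `L²(Ω; E)`. -/
def constantOperators (P : Measure Ω) (E : Type*) [NormedAddCommGroup E] [InnerProductSpace ℝ E]
    [CompleteSpace E] : StarSubalgebra ℝ (Lp E 2 P →L[ℝ] Lp E 2 P) :=
  (pointwiseAction P : (E →L[ℝ] E) →⋆ₐ[ℝ] _).range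

theorem compLpL_mem_approximable [IsProbabilityMeasure P] [MeasurableSpace E] [BorelSpace E]
    {ζ ε : ℤ →ᵇ Lp E 2 P} (hζ : ζ ∈ filterSpan (constantOperators P E) ε (Set.Iic 0))
    (hUI : UniformIntegrable (fun t => ⇑(ε t)) 2 P) (l : E →L[ℝ] ℝ) :
    (l.compLpL 2 P).compLeftContinuousBounded ℤ ζ ∈ approximable P (fun t => ⇑(ε t)) 2 := by
  refine map_mem_of_mem_filterSpan (K := approximable P (fun t => ⇑(ε t)) 2)
    (Submodule.isClosed_topologicalClosure _) ((l.compLpL 2 P).compLeftContinuousBounded ℤ) ?_ hζ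
  rintro s hs _ ⟨A, rfl⟩
  have he : ∀ t, Measurable (ε t) := fun t => (Lp.stronglyMeasurable (ε t)).measurable
  have hlA : ((l.comp A).compLpL 2 P).compLeftContinuousBounded ℤ ε
      ∈ approximable P (fun t => ⇑(ε t)) 2 :=
    mem_approximable_of_uniformIntegrable he ENNReal.ofNat_ne_top hUI (l.comp A) fun t =>
      (l.comp A).coeFn_compLpL (ε t)
  convert shift_mem_approximable hlA hs using 1
  ext1 t
  refine Lp.ext ?_
  filter_upwards [l.coeFn_compLpL (pointwiseAction P A (ε (t + s))),
    coeFn_pointwiseAction A (ε (t + s)), (l.comp A).coeFn_compLpL (ε (t + s))] with ω hl hA hlA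
  exact hl.trans ((congrArg l hA).trans hlA.symm)

end ConstantOperators

section SecondOrderStationarity

variable {Ω ι : Type*} [MeasurableSpace Ω] {P : Measure Ω} [Fintype ι]
  {z : ℤ → Ω → EuclideanSpace ℝ ι}

theorem closedSpan_eq_opSpan (hz : ∀ t, MemLp (z t) 2 P) (S : Set ℤ) :
    closedSpan P z S =
      opSpan (constantOperators P (EuclideanSpace ℝ ι)) (fun t => (hz t).toLp (z t)) S := by
  have hgen : ∀ (s : ℤ) (A : EuclideanSpace ℝ ι →L[ℝ] EuclideanSpace ℝ ι)
      (V : Lp (EuclideanSpace ℝ ι) 2 P),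
      (V =ᵐ[P] fun ω => A (z s ω)) ↔ pointwiseAction P A ((hz s).toLp (z s)) = V := by
    intro s A V
    have hA : pointwiseAction P A ((hz s).toLp (z s)) =ᵐ[P] fun ω => A (z s ω) :=
      (coeFn_pointwiseAction A _).trans ((hz s).coeFn_toLp.fun_comp A)
    exact ⟨fun h => Lp.ext (hA.trans h.symm), fun h => h ▸ hA⟩
  have hmem : ∀ (p : (Lp (EuclideanSpace ℝ ι) 2 P →L[ℝ] Lp (EuclideanSpace ℝ ι) 2 P) → Prop),
      (∃ B ∈ constantOperators P (EuclideanSpace ℝ ι), p B) ↔ ∃ A, p (pointwiseAction P A) :=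
    fun p => Set.exists_range_iff
  simp only [closedSpan, opSpan, hgen, hmem]

theorem innovation_eq_innov (hz : ∀ t, MemLp (z t) 2 P) :
    innovation P z hz =
      innov (constantOperators P (EuclideanSpace ℝ ι)) fun t => (hz t).toLp (z t) := by
  ext1 t
  simp only [innovation, innov, pastSpace, closedSpan_eq_opSpan hz]

theorem integral_bilin_eq_sum {v w : Ω → EuclideanSpace ℝ ι} (hv : MemLp v 2 P) (hw : MemLp w 2 P)
    (B : EuclideanSpace ℝ ι →ₗ[ℝ] EuclideanSpace ℝ ι →ₗ[ℝ] ℝ) :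
    ∫ ω, B (v ω) (w ω) ∂P = ∑ a, ∑ b,
      (∫ ω, v ω a * w ω b ∂P) *
        B (EuclideanSpace.basisFun ι ℝ a) (EuclideanSpace.basisFun ι ℝ b) := by
  have hint : ∀ a b, Integrable (fun ω => v ω a * w ω b) P := fun a b =>
    MemLp.integrable_mul ((EuclideanSpace.proj (𝕜 := ℝ) a).comp_memLp' hv)
      ((EuclideanSpace.proj (𝕜 := ℝ) b).comp_memLp' hw)
  have hB : ∀ ω, B (v ω) (w ω) = ∑ a, ∑ b, v ω a * w ω b *
      B (EuclideanSpace.basisFun ι ℝ a) (EuclideanSpace.basisFun ι ℝ b) := by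
    intro ω
    conv_lhs => rw [← (EuclideanSpace.basisFun ι ℝ).sum_repr (v ω),
      ← (EuclideanSpace.basisFun ι ℝ).sum_repr (w ω)]
    simp only [map_sum, map_smul, LinearMap.sum_apply, LinearMap.smul_apply, smul_eq_mul,
      EuclideanSpace.basisFun_repr, Finset.mul_sum]
    rw [Finset.sum_comm]
    exact Finset.sum_congr rfl fun a _ => Finset.sum_congr rfl fun b _ => by ring
  simp only [hB]
  rw [integral_finsetSum _ fun a _ => integrable_finsetSum _ fun b _ => (hint a b).mul_const _]
  refine Finset.sum_congr rfl fun a _ => ?_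
  rw [integral_finsetSum _ fun b _ => (hint a b).mul_const _]
  exact Finset.sum_congr rfl fun b _ => integral_mul_const _ _

theorem IsCovStationary.integral_apply_eq [IsFiniteMeasure P] (hz : IsCovStationary P z)
    (l : EuclideanSpace ℝ ι →L[ℝ] ℝ) (s t : ℤ) : ∫ ω, l (z s ω) ∂P = ∫ ω, l (z t ω) ∂P := by
  have h : ∀ t, ∫ ω, l (z t ω) ∂P = l (∫ ω, z t ω ∂P) := fun t =>
    l.integral_comp_comm ((hz.memLp t).integrable one_le_two)
  rw [h, h, hz.mean_eq s t]

variable [IsProbabilityMeasure P]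

theorem IsCovStationary.integral_mul_eq (hz : IsCovStationary P z) (s r t : ℤ) (a b : ι) :
    ∫ ω, z (t + s) ω a * z (t + r) ω b ∂P = ∫ ω, z s ω a * z r ω b ∂P := by
  have hcoord : ∀ t a, MemLp (fun ω => z t ω a) 2 P := fun t a =>
    (EuclideanSpace.proj (𝕜 := ℝ) a).comp_memLp' (hz.memLp t)
  have hcov := hz.cov_eq (s - r) (t + s) s a b
  have hmean : ∀ a (s t : ℤ), ∫ ω, z s ω a ∂P = ∫ ω, z t ω a ∂P := fun a =>
    hz.integral_apply_eq (EuclideanSpace.proj a)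
  rw [show t + s - (s - r) = t + r by ring, sub_sub_cancel,
    covariance_eq_sub (hcoord _ a) (hcoord _ b), covariance_eq_sub (hcoord _ a) (hcoord _ b),
    hmean a (t + s) s, hmean b (t + r) r, sub_left_inj] at hcov
  exact hcov

theorem IsCovStationary.integral_bilin_eq (hz : IsCovStationary P z)
    (B : EuclideanSpace ℝ ι →ₗ[ℝ] EuclideanSpace ℝ ι →ₗ[ℝ] ℝ) (s r t : ℤ) :
    ∫ ω, B (z (t + s) ω) (z (t + r) ω) ∂P = ∫ ω, B (z s ω) (z r ω) ∂P := by
  simp only [integral_bilin_eq_sum (hz.memLp _) (hz.memLp _), hz.integral_mul_eq s r t]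

theorem IsCovStationary.isOpStationary (hz : IsCovStationary P z) :
    IsOpStationary (constantOperators P (EuclideanSpace ℝ ι))
      fun t => (hz.memLp t).toLp (z t) := by
  rintro _ ⟨A, rfl⟩ s r t
  have hinner : ∀ s r, ⟪(hz.memLp s).toLp (z s), pointwiseAction P A ((hz.memLp r).toLp (z r))⟫_ℝ
      = ∫ ω, (innerₗ (EuclideanSpace ℝ ι)).compl₂ A.toLinearMap (z s ω) (z r ω) ∂P := by
    intro s r
    rw [L2.inner_def]
    refine integral_congr_ae ?_
    filter_upwards [coeFn_pointwiseAction A ((hz.memLp r).toLp (z r)), (hz.memLp s).coeFn_toLp,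
      (hz.memLp r).coeFn_toLp] with ω hA hs hr
    rw [hA, hs, hr]
    rfl
  exact (hinner _ _).trans ((hz.integral_bilin_eq _ s r t).trans (hinner s r).symm)

theorem IsCovStationary.exists_mem_filterSpan_innovation (hz : IsCovStationary P z)
    (hpnd : IsPurelyNondeterministic P z) :
    ∃ ζ ε : ℤ →ᵇ Lp (EuclideanSpace ℝ ι) 2 P, (∀ t, ζ t =ᵐ[P] z t) ∧
      ⇑ε = innovation P z hz.memLp ∧
      ζ ∈ filterSpan (constantOperators P (EuclideanSpace ℝ ι)) ε (Set.Iic 0) := by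
  let ζ : ℤ →ᵇ Lp (EuclideanSpace ℝ ι) 2 P :=
    .ofNormedAddCommGroupDiscrete _ _ fun t => (hz.isOpStationary.norm_eq t).le
  have hstat : IsOpStationary (constantOperators P (EuclideanSpace ℝ ι)) ζ := hz.isOpStationary
  obtain ⟨ε, -, hε⟩ := hstat.exists_innov_mem_filterSpan
  have hremote : ⨅ t, opSpan (constantOperators P (EuclideanSpace ℝ ι)) ζ (Set.Iic t) = ⊥ := by
    rw [← hpnd]
    exact iInf_congr fun t => (closedSpan_eq_opSpan hz.memLp _).symm
  exact ⟨ζ, ε, fun t => (hz.memLp t).coeFn_toLp, hε.trans (innovation_eq_innov hz.memLp).symm,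
    hstat.mem_filterSpan_innov hremote hε⟩

theorem FinitePredictorExactness.uniformIntegrable_innovation (h : FinitePredictorExactness P z) :
    UniformIntegrable (fun t => ⇑(innovation P z h.stationary.memLp t)) 2 P := by
  obtain ⟨δ, hδ, -, -, C, hC⟩ := h.mixing_moments
  have hq : 0 < 4 + 2 * δ := by positivity
  refine uniformIntegrable_of_eLpNorm_le (q := ENNReal.ofReal (4 + 2 * δ)) (C := C ^ (4 + 2 * δ)⁻¹)
    two_ne_zero ?_ (fun t => Lp.aestronglyMeasurable _) fun t => ?_
  · rw [← ENNReal.ofReal_ofNat 2, ENNReal.ofReal_lt_ofReal_iff hq]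
    linarith
  · rw [eLpNorm_eq_lintegral_rpow_enorm_toReal (ENNReal.ofReal_pos.2 hq).ne' ENNReal.ofReal_ne_top,
      ENNReal.toReal_ofReal hq.le, one_div, ENNReal.coe_rpow_of_nonneg _ (inv_nonneg.2 hq.le)]
    gcongr
    exact hC t

end SecondOrderStationarity

section AffineFunctionals

variable {Ω ι : Type*} [MeasurableSpace Ω] {P : Measure Ω} [Fintype ι]
  {z : ℤ → Ω → EuclideanSpace ℝ ι} {f g : ℤ → Ω → ℝ}

/-- The process `f` is a fixed affine function of the current value of `z`. -/
def IsAffine (z : ℤ → Ω → EuclideanSpace ℝ ι) (f : ℤ → Ω → ℝ) : Prop :=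
  ∃ (l : EuclideanSpace ℝ ι →L[ℝ] ℝ) (c : ℝ), ∀ t ω, f t ω = l (z t ω) + c

omit [MeasurableSpace Ω] [Fintype ι] in
theorem isAffine_const (c : ℝ) : IsAffine z fun _ _ => c :=
  ⟨0, c, fun _ _ => by simp⟩

omit [MeasurableSpace Ω] [Fintype ι] in
theorem isAffine_apply_add (a : ι) (c : ℝ) : IsAffine z fun t ω => z t ω a + c :=
  ⟨EuclideanSpace.proj a, c, fun _ _ => rfl⟩

variable [IsProbabilityMeasure P]

theorem IsAffine.memLp (hf : IsAffine z f) (hz : ∀ t, MemLp (z t) 2 P) (t : ℤ) :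
    MemLp (f t) 2 P := by
  obtain ⟨l, c, hl⟩ := hf
  rw [funext (hl t)]
  exact (l.comp_memLp' (hz t)).add (memLp_const c)

theorem IsAffine.integral_mul_eq (hf : IsAffine z f) (hg : IsAffine z g)
    (hz : IsCovStationary P z) (s t : ℤ) :
    ∫ ω, f s ω * g s ω ∂P = ∫ ω, f t ω * g t ω ∂P := by
  obtain ⟨l, c, hl⟩ := hf
  obtain ⟨m, d, hm⟩ := hg
  let B := (LinearMap.mul ℝ ℝ).compl₁₂ l.toLinearMap m.toLinearMap
  let h := d • l + c • m
  have hexpand : ∀ t ω, f t ω * g t ω = B (z t ω) (z t ω) + (h (z t ω) + c * d) := by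
    intro t ω
    rw [hl, hm]
    simp only [B, h, LinearMap.compl₁₂_apply, LinearMap.mul_apply', add_apply, smul_apply,
      ContinuousLinearMap.coe_coe, smul_eq_mul]
    ring
  have hBint : ∀ t, Integrable (fun ω => B (z t ω) (z t ω)) P := fun t =>
    (l.comp_memLp' (hz.memLp t)).integrable_mul (m.comp_memLp' (hz.memLp t))
  have hhint : ∀ t, Integrable (fun ω => h (z t ω)) P := fun t =>
    (h.comp_memLp' (hz.memLp t)).integrable one_le_two
  have hhcint : ∀ t, Integrable (fun ω => h (z t ω) + c * d) P := fun t =>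
    (hhint t).add (integrable_const _)
  have hB : ∀ t, ∫ ω, B (z t ω) (z t ω) ∂P = ∫ ω, B (z 0 ω) (z 0 ω) ∂P := fun t => by
    simpa only [add_zero] using hz.integral_bilin_eq B 0 0 t
  simp only [hexpand, integral_add (hBint _) (hhcint _), integral_add (hhint _)
    (integrable_const _), hB, hz.integral_apply_eq h s t]

theorem IsAffine.isApproximable (hf : IsAffine z f) (hz : IsCovStationary P z)
    (hpnd : IsPurelyNondeterministic P z)
    (hUI : UniformIntegrable (fun t => ⇑(innovation P z hz.memLp t)) 2 P) :
    IsApproximable P (fun t => ⇑(innovation P z hz.memLp t)) 2 f := by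
  obtain ⟨l, c, hl⟩ := hf
  obtain ⟨ζ, ε, hζ, hε, hmem⟩ := hz.exists_mem_filterSpan_innovation hpnd
  rw [← hε] at hUI ⊢
  have he : ∀ t, Measurable (ε t) := fun t => (Lp.stronglyMeasurable (ε t)).measurable
  have hlin : IsApproximable P (fun t => ⇑(ε t)) 2 fun t ω => l (z t ω) :=
    ⟨_, compLpL_mem_approximable hmem hUI l, fun t =>
      (l.coeFn_compLpL (ζ t)).trans ((hζ t).fun_comp l)⟩
  convert hlin.add (isApproximable_const he c) using 1
  exact funext₂ hl

end AffineFunctionals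

section ConvergenceInProbability

variable {Ω : Type*} [MeasurableSpace Ω] {P : Measure Ω}

theorem tendstoInMeasure_pi {τ κ : Type*} [Fintype κ] {F : Filter τ} {f : τ → Ω → κ → ℝ}
    {c : κ → ℝ} (h : ∀ k, TendstoInMeasure P (fun n ω => f n ω k) F fun _ => c k) :
    TendstoInMeasure P f F fun _ => c := by
  rw [tendstoInMeasure_iff_dist]
  intro r hr
  have hsum : Tendsto (fun n => ∑ k, P {ω | r ≤ dist (f n ω k) (c k)}) F (𝓝 0) := by
    simpa using tendsto_finsetSum Finset.univ fun k _ => tendstoInMeasure_iff_dist.1 (h k) r hr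
  refine tendsto_of_tendsto_of_tendsto_of_le_of_le tendsto_const_nhds hsum (fun _ => zero_le)
    fun n => (measure_mono fun ω hω => ?_).trans (measure_iUnion_fintype_le P _)
  by_contra hcon
  simp only [Set.mem_iUnion, Set.mem_ofPred_eq, not_exists, not_le] at hcon
  exact absurd ((dist_pi_lt_iff hr).2 hcon) (not_lt.2 hω)

theorem tendstoInMeasure_comp_of_continuousAt {τ E F : Type*} [PseudoMetricSpace E]
    [PseudoMetricSpace F] {l : Filter τ} {f : τ → Ω → E} {c : E} {G : E → F}
    (h : TendstoInMeasure P f l fun _ => c) (hG : ContinuousAt G c) :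
    TendstoInMeasure P (fun n ω => G (f n ω)) l fun _ => G c := by
  rw [tendstoInMeasure_iff_dist] at h ⊢
  intro r hr
  obtain ⟨d, hd, hdr⟩ := Metric.continuousAt_iff.1 hG r hr
  refine tendsto_of_tendsto_of_tendsto_of_le_of_le tendsto_const_nhds (h d hd)
    (fun _ => zero_le) fun n => measure_mono fun ω hω => ?_
  by_contra hcon
  exact absurd (hdr (not_le.1 hcon)) (not_lt.2 hω)

end ConvergenceInProbability

section LeastSquares

variable {n : Type*} [Fintype n] [DecidableEq n]

theorem inv_smul_mulVec_smul {r : ℝ} (hr : r ≠ 0) (A : Matrix n n ℝ) (v : n → ℝ) :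
    (r • A)⁻¹ *ᵥ (r • v) = A⁻¹ *ᵥ v := by
  by_cases h : IsUnit A.det
  · have := invertibleOfNonzero hr
    rw [Matrix.inv_smul A r h, Matrix.smul_mulVec, Matrix.mulVec_smul, smul_smul, invOf_mul_self,
      one_smul]
  · have h' : ¬ IsUnit (r • A).det := by
      simpa [Matrix.det_smul, isUnit_iff_ne_zero, hr] using h
    simp only [Matrix.nonsing_inv_apply_not_isUnit _ h, Matrix.nonsing_inv_apply_not_isUnit _ h',
      Matrix.zero_mulVec]

/-- The least-squares coefficients `A⁻¹ (A κ + b)`, as a function of the pair of `A`, the matrix of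
second moments of the regressors, and `b`, their cross moments with the errors. The entries of `A`
and `b` are collected in one real vector, for which convergence in probability is entrywise. -/
def lsMap (κ : n → ℝ) (v : (n × n) ⊕ n → ℝ) : n → ℝ :=
  (Matrix.of fun i j => v (Sum.inl (i, j)))⁻¹ *ᵥ
    ((Matrix.of fun i j => v (Sum.inl (i, j))) *ᵥ κ + fun i => v (Sum.inr i))

theorem continuousAt_lsMap (κ : n → ℝ) {v : (n × n) ⊕ n → ℝ}
    (hv : (Matrix.of fun i j => v (Sum.inl (i, j))).det ≠ 0) : ContinuousAt (lsMap κ) v := by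
  have hA : Continuous fun v : (n × n) ⊕ n → ℝ =>
      (Matrix.of fun i j => v (Sum.inl (i, j)) : Matrix n n ℝ) :=
    continuous_matrix fun i j => continuous_apply _
  have hinv : ContinuousAt (fun v : (n × n) ⊕ n → ℝ =>
      (Matrix.of fun i j => v (Sum.inl (i, j)) : Matrix n n ℝ)⁻¹) v := by
    simp only [Matrix.inv_def, Ring.inverse_eq_inv']
    exact (hA.matrix_det.continuousAt.inv₀ hv).smul hA.matrix_adjugate.continuousAt
  have hvec : Continuous fun v : (n × n) ⊕ n → ℝ =>
      (Matrix.of fun i j => v (Sum.inl (i, j)) : Matrix n n ℝ) *ᵥ κ + fun i => v (Sum.inr i) :=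
    (hA.matrix_mulVec continuous_const).add (continuous_pi fun i => continuous_apply _)
  have hmul : Continuous fun q : Matrix n n ℝ × (n → ℝ) => q.1 *ᵥ q.2 :=
    continuous_fst.matrix_mulVec continuous_snd
  exact hmul.continuousAt.comp (hinv.prodMk hvec.continuousAt)

theorem lsMap_elim (κ b : n → ℝ) {A : Matrix n n ℝ} (hA : A.det ≠ 0) :
    lsMap κ (Sum.elim (fun q => A q.1 q.2) b) = κ + A⁻¹ *ᵥ b := by
  change A⁻¹ *ᵥ (A *ᵥ κ + b) = _
  rw [Matrix.mulVec_add, Matrix.mulVec_mulVec, Matrix.nonsing_inv_mul _ (isUnit_iff_ne_zero.2 hA),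
    Matrix.one_mulVec]

end LeastSquares

section OrdinaryLeastSquares

variable {Ω : Type*} [MeasurableSpace Ω] {P : Measure Ω} {N : ℕ} {k : Fin N → ℕ}
  {x : (i : Fin N) → ℤ → Ω → Fin (k i) → ℝ} {u y : ℤ → Ω → Fin N → ℝ}
  {α : Fin N → ℝ} {β μx : (i : Fin N) → Fin (k i) → ℝ}

theorem EZu_eq (hu : ∀ (t : ℤ) (i : Fin N), ∫ ω, u t ω i ∂P = 0) (t : ℤ) :
    EZu P x u t = Sum.elim (0 : Fin N → ℝ) (EXu P x u t) := by
  ext (i | p)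
  · simp [EZu, Z, Matrix.fromRows_mulVec, hu]
  · simp [EZu, EXu, Z, Matrix.fromRows_mulVec]

section Algebra

omit [MeasurableSpace Ω]

theorem isAffine_Z (a : Fin N ⊕ (Σ i, Fin (k i))) (i : Fin N) :
    IsAffine (zbar x u μx) fun t ω => Z x t ω a i := by
  rcases a with j | p
  · exact isAffine_const ((1 : Matrix (Fin N) (Fin N) ℝ) j i)
  · by_cases h : p.1 = i
    · convert isAffine_apply_add (z := zbar x u μx) (Sum.inl p) (μx p.1 p.2) using 3
      simp [Z, X, zbar, h]
    · convert isAffine_const (z := zbar x u μx) 0 using 3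
      simp [Z, X, h]

theorem isAffine_u (i : Fin N) : IsAffine (zbar x u μx) fun t ω => u t ω i := by
  convert isAffine_apply_add (z := zbar x u μx) (Sum.inr i) 0 using 3
  simp [zbar]

theorem transpose_Z_mulVec_kappa (α : Fin N → ℝ) (β : (i : Fin N) → Fin (k i) → ℝ) (t : ℤ)
    (ω : Ω) (i : Fin N) :
    ((Z x t ω)ᵀ *ᵥ kappa α β) i = α i + ∑ j, x i t ω j * β i j := by
  simp only [Matrix.mulVec, dotProduct, Fintype.sum_sum_type, Matrix.transpose_apply, Z, kappa,
    Matrix.fromRows_apply_inl, Matrix.fromRows_apply_inr, Sum.elim_inl, Sum.elim_inr, X,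
    Matrix.of_apply, Fintype.sum_sigma]
  congr 1
  · simp [Matrix.one_apply]
  · rw [Finset.sum_eq_single i (fun b _ hb => by simp [hb]) (by simp)]
    simp

/-- The averages over `t = 1, …, T` of the entries of `Z_t Z_t'` and of `Z_t u_t`, in the form of an
argument of `lsMap`. -/
def averages (x : (i : Fin N) → ℤ → Ω → Fin (k i) → ℝ) (u : ℤ → Ω → Fin N → ℝ) (T : ℕ) (ω : Ω) :
    ((Fin N ⊕ (Σ i, Fin (k i))) × (Fin N ⊕ (Σ i, Fin (k i)))) ⊕ (Fin N ⊕ (Σ i, Fin (k i))) → ℝ :=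
  Sum.elim
    (fun a => (T : ℝ)⁻¹ * ∑ t ∈ Finset.Icc 1 T, (Z x (t : ℤ) ω * (Z x (t : ℤ) ω)ᵀ) a.1 a.2)
    (fun a => (T : ℝ)⁻¹ * ∑ t ∈ Finset.Icc 1 T, (Z x (t : ℤ) ω *ᵥ u (t : ℤ) ω) a)

theorem ols_eq_lsMap {T : ℕ} (hT : 1 ≤ T) {ω : Ω}
    (hy : ∀ t : ℤ, 1 ≤ t → ∀ i, y t ω i = α i + ∑ j, x i t ω j * β i j + u t ω i) :
    ols x y T ω = lsMap (kappa α β) (averages x u T ω) := by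
  have hT0 : (T : ℝ)⁻¹ ≠ 0 := by positivity
  have hZy : ∀ t ∈ Finset.Icc 1 T, Z x (t : ℤ) ω *ᵥ y (t : ℤ) ω
      = (Z x (t : ℤ) ω * (Z x (t : ℤ) ω)ᵀ) *ᵥ kappa α β + Z x (t : ℤ) ω *ᵥ u (t : ℤ) ω := by
    intro t ht
    rw [← Matrix.mulVec_mulVec, ← Matrix.mulVec_add]
    congr 1
    ext i
    rw [Pi.add_apply, transpose_Z_mulVec_kappa]
    exact hy t (by exact_mod_cast (Finset.mem_Icc.1 ht).1) i
  have hZZ : (Matrix.of fun i j => averages x u T ω (Sum.inl (i, j)))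
      = (T : ℝ)⁻¹ • ∑ t ∈ Finset.Icc 1 T, Z x (t : ℤ) ω * (Z x (t : ℤ) ω)ᵀ := by
    ext i j
    simp [averages, Matrix.sum_apply]
  have hZu : (fun i => averages x u T ω (Sum.inr i))
      = (T : ℝ)⁻¹ • ∑ t ∈ Finset.Icc 1 T, Z x (t : ℤ) ω *ᵥ u (t : ℤ) ω := by
    ext i
    simp [averages]
  rw [ols, lsMap, hZZ, hZu, Matrix.smul_mulVec, ← smul_add, inv_smul_mulVec_smul hT0,
    Finset.sum_congr rfl hZy, Finset.sum_add_distrib, Matrix.sum_mulVec]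

end Algebra

variable [IsProbabilityMeasure P]

theorem tendstoInMeasure_average_sum_mul {ι κ : Type*} [Fintype ι] [Fintype κ]
    {z : ℤ → Ω → EuclideanSpace ℝ ι} (hz : IsCovStationary P z)
    (hpnd : IsPurelyNondeterministic P z)
    (hmix : Tendsto (mixingCoeff P fun t => ⇑(innovation P z hz.memLp t)) atTop (𝓝 0))
    (hUI : UniformIntegrable (fun t => ⇑(innovation P z hz.memLp t)) 2 P)
    {f g : κ → ℤ → Ω → ℝ} (hf : ∀ i, IsAffine z (f i)) (hg : ∀ i, IsAffine z (g i)) (t : ℤ) :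
    TendstoInMeasure P (fun (T : ℕ) ω => (T : ℝ)⁻¹ * ∑ t ∈ Finset.Icc 1 T,
      ∑ i, f i t ω * g i t ω) atTop fun _ => ∫ ω, ∑ i, f i t ω * g i t ω ∂P := by
  have happrox : IsApproximable P (fun t => ⇑(innovation P z hz.memLp t)) 1
      fun t ω => ∑ i, f i t ω * g i t ω := by
    convert IsApproximable.sum (s := Finset.univ) fun i _ =>
      ((hf i).isApproximable hz hpnd hUI).mul ((hg i).isApproximable hz hpnd hUI) using 1
    ext t ω
    simp only [Finset.sum_apply, Pi.mul_apply]
  have hint : ∀ s i, Integrable (fun ω => f i s ω * g i s ω) P := fun s i =>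
    ((hf i).memLp hz.memLp s).integrable_mul ((hg i).memLp hz.memLp s)
  refine happrox.tendstoInMeasure_average
    (fun t => (Lp.stronglyMeasurable (innovation P z hz.memLp t)).measurable) hmix fun s => ?_
  rw [integral_finsetSum _ fun i _ => hint s i, integral_finsetSum _ fun i _ => hint t i]
  exact Finset.sum_congr rfl fun i _ => (hf i).integral_mul_eq (hg i) hz s t

theorem tendstoInMeasure_averages (hz : IsCovStationary P (zbar x u μx))
    (hpnd : IsPurelyNondeterministic P (zbar x u μx))
    (hmix : Tendsto (mixingCoeff P fun t => ⇑(innovation P _ hz.memLp t)) atTop (𝓝 0))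
    (hUI : UniformIntegrable (fun t => ⇑(innovation P _ hz.memLp t)) 2 P) (t : ℤ) :
    TendstoInMeasure P (averages x u) atTop
      fun _ => Sum.elim (fun a => QZ P x t a.1 a.2) (EZu P x u t) := by
  refine tendstoInMeasure_pi ?_
  rintro (⟨a, b⟩ | a)
  · simpa only [averages, QZ, Sum.elim_inl, Matrix.of_apply, Matrix.mul_apply,
      Matrix.transpose_apply] using
      tendstoInMeasure_average_sum_mul hz hpnd hmix hUI (isAffine_Z a) (isAffine_Z b) t
  · simpa only [averages, EZu, Sum.elim_inr, Matrix.mulVec, dotProduct] using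
      tendstoInMeasure_average_sum_mul hz hpnd hmix hUI (isAffine_Z a) isAffine_u t

theorem convergesInProbTo_ols (hz : IsCovStationary P (zbar x u μx))
    (hpnd : IsPurelyNondeterministic P (zbar x u μx))
    (hmix : Tendsto (mixingCoeff P fun t => ⇑(innovation P _ hz.memLp t)) atTop (𝓝 0))
    (hUI : UniformIntegrable (fun t => ⇑(innovation P _ hz.memLp t)) 2 P)
    (hy : ∀ t : ℤ, 1 ≤ t → ∀ i : Fin N,
      ∀ᵐ ω ∂P, y t ω i = α i + ∑ j, x i t ω j * β i j + u t ω i)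
    {t : ℤ} (hQ : (QZ P x t).det ≠ 0) :
    ConvergesInProbTo P (ols x y) (kappa α β + (QZ P x t)⁻¹ *ᵥ EZu P x u t) := by
  have hlim : TendstoInMeasure P (fun T ω => lsMap (kappa α β) (averages x u T ω)) atTop
      fun _ => kappa α β + (QZ P x t)⁻¹ *ᵥ EZu P x u t := by
    rw [← lsMap_elim _ _ hQ]
    exact tendstoInMeasure_comp_of_continuousAt (tendstoInMeasure_averages hz hpnd hmix hUI t)
      (continuousAt_lsMap (kappa α β) hQ)
  have hmodel : ∀ᵐ ω ∂P, ∀ t : ℤ, 1 ≤ t → ∀ i,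
      y t ω i = α i + ∑ j, x i t ω j * β i j + u t ω i :=
    ae_all_iff.2 fun t => eventually_imp_distrib_left.2 fun ht => ae_all_iff.2 (hy t ht)
  refine hlim.congr' ?_ EventuallyEq.rfl
  filter_upwards [eventually_ge_atTop 1] with T hT
  filter_upwards [hmodel] with ω hω
  exact (ols_eq_lsMap hT hω).symm

theorem convergesInProbTo_left_iff_eq_zero {n : Type*} [Fintype n] [DecidableEq n]
    {est : ℕ → Ω → n → ℝ} {θ b : n → ℝ} {A : Matrix n n ℝ} (hA : A.det ≠ 0)
    (h : ConvergesInProbTo P est (θ + A⁻¹ *ᵥ b)) : ConvergesInProbTo P est θ ↔ b = 0 := by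
  refine ⟨fun hθ => ?_, fun hb => by simpa [hb] using h⟩
  obtain ⟨ω, hω⟩ := (tendstoInMeasure_ae_unique h hθ).exists
  have hinv : A⁻¹ *ᵥ b = 0 := by simpa using hω
  calc b = A *ᵥ (A⁻¹ *ᵥ b) := by
        rw [Matrix.mulVec_mulVec, Matrix.mul_nonsing_inv _ (isUnit_iff_ne_zero.2 hA),
          Matrix.one_mulVec]
    _ = 0 := by rw [hinv, Matrix.mulVec_zero]

end OrdinaryLeastSquares

end SUR

end

theorem proposition3_general {Ω : Type*} [MeasurableSpace Ω] (P : Measure Ω)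
    [IsProbabilityMeasure P] {N : ℕ} {k : Fin N → ℕ}
    (x : (i : Fin N) → ℤ → Ω → Fin (k i) → ℝ) (u y : ℤ → Ω → Fin N → ℝ)
    (α : Fin N → ℝ) (β μx : (i : Fin N) → Fin (k i) → ℝ)
    (hy : ∀ t : ℤ, 1 ≤ t → ∀ i : Fin N,
      ∀ᵐ ω ∂P, y t ω i = α i + ∑ j, x i t ω j * β i j + u t ω i)
    (hu : ∀ (t : ℤ) (i : Fin N), ∫ ω, u t ω i ∂P = 0)
    (_hx : ∀ (t : ℤ) (i : Fin N) (j : Fin (k i)), ∫ ω, x i t ω j ∂P = μx i j)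
    (hstat : SUR.IsCovStationary P (SUR.zbar x u μx))
    (hpnd : SUR.IsPurelyNondeterministic P (SUR.zbar x u μx))
    (hmix : Tendsto (SUR.mixingCoeff P fun t =>
      ⇑(SUR.innovation P (SUR.zbar x u μx) hstat.memLp t)) atTop (𝓝 0))
    (hUI : UniformIntegrable (fun t => ⇑(SUR.innovation P (SUR.zbar x u μx) hstat.memLp t)) 2 P)
    (t : ℤ) (hQ : (SUR.QZ P x t).PosDef) :
    (SUR.ConvergesInProbTo P (SUR.ols x y) (SUR.kappa α β) ↔ SUR.EZu P x u t = 0) ∧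
    (SUR.ConvergesInProbTo P (SUR.ols x y) (SUR.kappa α β) ↔ SUR.EXu P x u t = 0) ∧
    SUR.ConvergesInProbTo P (SUR.ols x y)
      (SUR.kappa α β + (SUR.QZ P x t)⁻¹ *ᵥ Sum.elim 0 (SUR.EXu P x u t)) := by
  have hdet : (SUR.QZ P x t).det ≠ 0 := hQ.det_pos.ne'
  have hEZu := SUR.EZu_eq (x := x) hu t
  have hlim := SUR.convergesInProbTo_ols hstat hpnd hmix hUI hy hdet
  have hconsistent := SUR.convergesInProbTo_left_iff_eq_zero hdet hlim
  have hEXu : SUR.EZu P x u t = 0 ↔ SUR.EXu P x u t = 0 := by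
    rw [hEZu]
    exact ⟨fun h => funext fun p => congrFun h (Sum.inr p), fun h => by rw [h, Sum.elim_zero_zero]⟩
  exact ⟨hconsistent, hconsistent.trans hEXu, hEZu ▸ hlim⟩

theorem proposition3 {Ω : Type*} [MeasurableSpace Ω] (P : Measure Ω) [IsProbabilityMeasure P]
    {N : ℕ} {k : Fin N → ℕ}
    (x : (i : Fin N) → ℤ → Ω → Fin (k i) → ℝ) (u y : ℤ → Ω → Fin N → ℝ)
    (α : Fin N → ℝ) (β μx : (i : Fin N) → Fin (k i) → ℝ)
    (hy : ∀ t : ℤ, 1 ≤ t → ∀ i : Fin N,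
      ∀ᵐ ω ∂P, y t ω i = α i + ∑ j, x i t ω j * β i j + u t ω i)
    (hu : ∀ (t : ℤ) (i : Fin N), ∫ ω, u t ω i ∂P = 0)
    (hx : ∀ (t : ℤ) (i : Fin N) (j : Fin (k i)), ∫ ω, x i t ω j ∂P = μx i j)
    (hA1 : SUR.FinitePredictorExactness P (SUR.zbar x u μx))
    (t : ℤ) (hA2 : (SUR.QZ P x t).PosDef) :
    (SUR.ConvergesInProbTo P (SUR.ols x y) (SUR.kappa α β) ↔ SUR.EZu P x u t = 0) ∧
    (SUR.ConvergesInProbTo P (SUR.ols x y) (SUR.kappa α β) ↔ SUR.EXu P x u t = 0) ∧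
    SUR.ConvergesInProbTo P (SUR.ols x y)
      (SUR.kappa α β + (SUR.QZ P x t)⁻¹ *ᵥ Sum.elim 0 (SUR.EXu P x u t)) :=
  let ⟨_, _, hmix, _⟩ := hA1.mixing_moments
  proposition3_general P x u y α β μx hy hu hx hA1.stationary hA1.nondeterministic hmix
    hA1.uniformIntegrable_innovation t hA2
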